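/- Fix an infinite set of variables. Formulas of the modal $\mu$-calculus are given by $\varphi ::= \top \mid \bot \mid x \mid \neg x \mid \varphi\wedge\varphi \mid \varphi\vee\varphi \mid \Diamond\varphi \mid \Box\varphi \mid \mu x.\varphi \mid \nu x.\varphi$, where $\eta x.\varphi$ ($\eta\in\{\mu,\nu\}$) may only be formed if $\varphi$ is *positive* in $x$, i.e. $\neg x$ does not occur in $\varphi$. A formula $\xi$ is *tidy* if $FV(\xi)\cap BV(\xi)=\varnothing$. A formula $\psi$ is *free for $x$ in $\varphi$* if $\varphi$ is positive in $x$ and no free occurrence of $x$ in $\varphi$ lies in the scope of an operator $\eta y$ with $y\in FV(\psi)$; then $\varphi[\psi/x]$ is the result of substituting $\psi$ for all free occurrences of $x$. Write $\overline{\mu}=\nu$, $\overline{\nu}=\mu$; $\mu$ has odd and $\nu$ has even parity. *Alternation depth.* The classes $\Theta^{\eta}_{n}$ ($\eta\in\{\mu,\nu\}$, $n\in\mathbb N$) are the least classes of formulas such that: (1) $\Theta^\eta_0$ contains $\top$, $\bot$ and all literals; (2) $\Theta^\eta_n$ is closed under $\wedge,\vee,\Diamond,\Box$; (3) if $\varphi\in\Theta^\eta_n$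 then $\overline{\eta}x.\varphi\in\Theta^\eta_n$ (whenever this is a formula); (4) if $\varphi,\psi\in\Theta^\eta_n$ and $\psi$ is free for $x$ in $\varphi$ then $\varphi[\psi/x]\in\Theta^\eta_n$; (5) $\Theta^{\lambda}_n\subseteq\Theta^\eta_{n+1}$ for all $\lambda\in\{\mu,\nu\}$. The alternation depth $\mathit{ad}(\xi)$ is the least $n$ with $\xi\in\Theta^\mu_n\cap\Theta^\nu_n$. *Closure graph.* The trace relation $\to_C$ on tidy formulas is given by $\varphi_0\odot\varphi_1\to_C\varphi_i$ ($\odot\in\{\wedge,\vee\}$, $i\in\{0,1\}$), $\heartsuit\varphi\to_C\varphi$ ($\heartsuit\in\{\Diamond,\Box\}$) and $\eta x.\varphi\to_C\varphi[\eta x.\varphi/x]$; let $\twoheadrightarrow_C$ be its reflexive-transitive closure, $\mathit{Clos}(\xi)=\{\varphi\mid\xi\twoheadrightarrow_C\varphi\}$, and let $C(\varphi)$, the *cluster* of $\varphi$, be the set of all $\psi$ with $\varphi\twoheadrightarrow_C\psi\twoheadrightarrow_C\varphi$. Say that $\varphi$ is a *free subformula* of $\psi$ if $\psi=\psi'[\varphi/x]$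 for some formula $\psi'$ and some $x\in FV(\psi')$ such that $\varphi$ is free for $x$ in $\psi'$. For fixpoint formulas (formulas of the form $\eta x.\chi$) put $\varphi\sqsubseteq_C\psi$ if there is a trace $\psi=\chi_0\to_C\cdots\to_C\chi_n=\varphi$ with $\psi$ a free subformula of every $\chi_i$, and $\varphi\sqsubset_C\psi$ if $\varphi\sqsubseteq_C\psi$ and $\psi\not\sqsubseteq_C\varphi$. An *alternating $\sqsubset_C$-chain* of length $n$ is a sequence $\eta_1x_1.\chi_1\sqsubset_C\cdots\sqsubset_C\eta_nx_n.\chi_n$ of tidy fixpoint formulas with $\eta_{i+1}=\overline{\eta_i}$ for $1\le i<n$; it *starts at* $\eta_1x_1.\chi_1$. Let $h^{\uparrow}(\psi)$ be the maximal length of such a chain starting at $\psi$, and $\mathit{cd}(C)$ the maximal length of such a chain inside the cluster $C$. For a tidy fixpoint formula $\psi=\eta y.\varphi$ put $d=\mathit{cd}(C(\psi))-h^{\uparrow}(\psi)$, and let $\Omega_g(\psi)=d$ if $d$ has parity $\eta$ and $\Omega_g(\psi)=d+1$ otherwise; $\Omega_g$ is undefined on all other formulas. *Index.* A parity formula over a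 finite set $P$ of proposition letters is a tuple $(V,E,L,\Omega,v_I)$ consisting of a finite directed graph $(V,E)$, a labelling $L$ of its nodes by $\top,\bot$, literals over $P$, $\wedge,\vee,\Diamond,\Box$ or $\epsilon$, a partial map $\Omega:V\rightharpoonup\mathbb N$ and a node $v_I\in V$, such that every node has at most two successors, none if its label is atomic and exactly one if its label is $\Diamond$, $\Box$ or $\epsilon$, and such that every cycle contains a node in the domain of $\Omega$. Its *index* $\mathit{ind}$ is the maximal $k$ for which there are nodes $v_1,\dots,v_k$ in the domain of $\Omega$, all in one cluster of $(V,E)$ (mutually reachable), such that, for all $1\le i<k$, $\Omega(v_i)<\Omega(v_{i+1})$ and these two priorities have different parity. For a tidy formula $\xi$, let $\mathbb G_\xi$ be the parity formula over $FV(\xi)$ with node set $\mathit{Clos}(\xi)$, edge relation $\to_C$, initial node $\xi$, priority map $\Omega_g$ restricted to $\mathit{Clos}(\xi)$, and the labelling that sends an atomic formula to itself, a formula with main connective $\wedge,\vee,\Diamond,\Box$ to that connective, and a fixpoint formula to $\epsilon$. **Proposition.** For every tidy formula $\xi$ we have $\mathit{ind}(\mathbb G_\xi)\le\mathit{ad}(\xi)$.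 -/

import Mathlib

open Relation

universe u

namespace MuCalc

/-- The two fixpoint operators. -/
inductive FixOp where
  | mu
  | nu

/-- The dual fixpoint operator. -/
def FixOp.dual : FixOp → FixOp
  | .mu => .nu
  | .nu => .mu

/-- A natural number has parity `η`: odd for `μ`, even for `ν`. -/
def FixOp.HasParity : FixOp → ℕ → Prop
  | .mu, n => Odd n
  | .nu, n => Even n

/-- Raw formulas. The same variables serve as proposition letters and as fixpoint variables. -/
inductive Form (Var : Type u) : Type u where
  | top : Form Var
  | bot : Form Var
  | var : Var → Form Var
  | nvar : Var → Form Var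
  | and : Form Var → Form Var → Form Var
  | or : Form Var → Form Var → Form Var
  | dia : Form Var → Form Var
  | box : Form Var → Form Var
  | fix : FixOp → Var → Form Var → Form Var

namespace Form

variable {Var : Type u}

/-- Free variables. -/
def FV [DecidableEq Var] : Form Var → Finset Var
  | top => ∅
  | bot => ∅
  | var x => {x}
  | nvar x => {x}
  | and φ ψ => φ.FV ∪ ψ.FV
  | or φ ψ => φ.FV ∪ ψ.FV
  | dia φ => φ.FV
  | box φ => φ.FV
  | fix _ x φ => φ.FV.erase x

/-- Bound variables. -/
def BV [DecidableEq Var] : Form Var → Finset Var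
  | top => ∅
  | bot => ∅
  | var _ => ∅
  | nvar _ => ∅
  | and φ ψ => φ.BV ∪ ψ.BV
  | or φ ψ => φ.BV ∪ ψ.BV
  | dia φ => φ.BV
  | box φ => φ.BV
  | fix _ x φ => insert x φ.BV

/-- The literal `¬x` does not occur in the formula. -/
def PositiveIn (x : Var) : Form Var → Prop
  | top => True
  | bot => True
  | var _ => True
  | nvar y => y ≠ x
  | and φ ψ => φ.PositiveIn x ∧ ψ.PositiveIn x
  | or φ ψ => φ.PositiveIn x ∧ ψ.PositiveIn x
  | dia φ => φ.PositiveIn x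
  | box φ => φ.PositiveIn x
  | fix _ _ φ => φ.PositiveIn x

/-- The raw formula is a formula of the modal `μ`-calculus: `ηx.φ` is only formed when `φ` is
positive in `x`. -/
def WF : Form Var → Prop
  | top => True
  | bot => True
  | var _ => True
  | nvar _ => True
  | and φ ψ => φ.WF ∧ ψ.WF
  | or φ ψ => φ.WF ∧ ψ.WF
  | dia φ => φ.WF
  | box φ => φ.WF
  | fix _ x φ => φ.PositiveIn x ∧ φ.WF

/-- A formula is tidy if no variable occurs both free and bound in it. -/
def Tidy [DecidableEq Var] (φ : Form Var) : Prop :=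
  φ.WF ∧ Disjoint φ.FV φ.BV

/-- `⊤`, `⊥` and literals. -/
def IsAtomic : Form Var → Prop
  | top | bot | var _ | nvar _ => True
  | _ => False

/-- `φ.subst x τ` is `φ[τ/x]`: every free (positive) occurrence of `x` is replaced by `τ`. This is
only meaningful if `τ` is free for `x` in `φ`. -/
def subst [DecidableEq Var] (φ : Form Var) (x : Var) (τ : Form Var) : Form Var :=
  match φ with
  | top => top
  | bot => bot
  | var y => if y = x then τ else var y
  | nvar y => nvar y
  | and φ ψ => and (φ.subst x τ) (ψ.subst x τ)
  | or φ ψ => or (φ.subst x τ) (ψ.subst x τ)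
  | dia φ => dia (φ.subst x τ)
  | box φ => box (φ.subst x τ)
  | fix η y φ => if y = x then fix η y φ else fix η y (φ.subst x τ)

/-- No free occurrence of `x` in the formula lies in the scope of an operator binding a free
variable of `τ`. -/
def NoCapture [DecidableEq Var] (φ : Form Var) (τ : Form Var) (x : Var) : Prop :=
  match φ with
  | top => True
  | bot => True
  | var _ => True
  | nvar _ => True
  | and φ ψ => φ.NoCapture τ x ∧ ψ.NoCapture τ x
  | or φ ψ => φ.NoCapture τ x ∧ ψ.NoCapture τ x
  | dia φ => φ.NoCapture τ x
  | box φ => φ.NoCapture τ x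
  | fix _ y φ => x ∉ φ.FV.erase y ∨ (y ∉ τ.FV ∧ φ.NoCapture τ x)

/-- `τ` is free for `x` in `φ`. -/
def FreeFor [DecidableEq Var] (τ : Form Var) (x : Var) (φ : Form Var) : Prop :=
  φ.PositiveIn x ∧ φ.NoCapture τ x

/-- The leading fixpoint operator, if the formula is a fixpoint formula. -/
def fixOp? : Form Var → Option FixOp
  | fix η _ _ => some η
  | _ => none

/-- `φ` is a fixpoint formula. -/
def IsFix (φ : Form Var) : Prop := ∃ η, φ.fixOp? = some η

/-- `φ ⊴_f ψ`: `φ` is a free subformula of `ψ`. -/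
def FreeSub [DecidableEq Var] (φ ψ : Form Var) : Prop :=
  ∃ (ψ' : Form Var) (x : Var), ψ'.WF ∧ x ∈ ψ'.FV ∧ FreeFor φ x ψ' ∧ ψ = ψ'.subst x φ

end Form

open Form

section Closure

variable {Var : Type u} [DecidableEq Var]

/-- The trace relation `φ →_C ψ`. -/
inductive Step : Form Var → Form Var → Prop
  | and_left (φ ψ : Form Var) : Step (and φ ψ) φ
  | and_right (φ ψ : Form Var) : Step (and φ ψ) ψ
  | or_left (φ ψ : Form Var) : Step (or φ ψ) φ
  | or_right (φ ψ : Form Var) : Step (or φ ψ) ψ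
  | dia (φ : Form Var) : Step (dia φ) φ
  | box (φ : Form Var) : Step (box φ) φ
  | unfold (η : FixOp) (x : Var) (φ : Form Var) : Step (fix η x φ) (φ.subst x (fix η x φ))

/-- `φ ↠_C ψ`: there is a (possibly trivial) trace from `φ` to `ψ`. -/
def Reach : Form Var → Form Var → Prop := ReflTransGen Step

/-- The closure of a formula. -/
def Clos (ξ : Form Var) : Set (Form Var) := {φ | Reach ξ φ}

/-- `φ ≡_C ψ`: the formulas lie in the same closure cluster. -/
def SameCluster (φ ψ : Form Var) : Prop := Reach φ ψ ∧ Reach ψ φ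

/-- `ρ ↠_C^ψ σ`: there is a trace from `ρ` to `σ` all of whose members have `ψ` as a free
subformula. -/
def ReachVia (ψ ρ σ : Form Var) : Prop :=
  FreeSub ψ ρ ∧ ReflTransGen (fun α β => Step α β ∧ FreeSub ψ β) ρ σ

/-- `φ ⊑_C ψ`, the closure priority relation on fixpoint formulas. -/
def ClosLE (φ ψ : Form Var) : Prop := IsFix φ ∧ IsFix ψ ∧ ReachVia ψ ψ φ

/-- `φ ⊏_C ψ`. -/
def ClosLT (φ ψ : Form Var) : Prop := ClosLE φ ψ ∧ ¬ ClosLE ψ φ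

/-- Alternating `⊏_C`-chains of tidy fixpoint formulas, as lists with the least significant
formula first. -/
def IsAltChain (l : List (Form Var)) : Prop :=
  (∀ φ ∈ l, Tidy φ ∧ IsFix φ) ∧
  l.IsChain fun φ ψ => ClosLT φ ψ ∧ ψ.fixOp? = φ.fixOp?.map FixOp.dual

/-- `h↑(ξ)`: the maximal length of an alternating `⊏_C`-chain starting at `ξ`. (For tidy `ξ` such
chains stay in the finite cluster of `ξ` and have no repetitions, so the maximum exists.) -/
noncomputable def hUp (ξ : Form Var) : ℕ :=
  sSup {n | ∃ l : List (Form Var), IsAltChain l ∧ l.head? = some ξ ∧ l.length = n}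

/-- `cd(C(φ))`: the closure depth of the cluster of `φ`, that is, the maximal length of an
alternating `⊏_C`-chain in this cluster. -/
noncomputable def closureDepth (φ : Form Var) : ℕ :=
  sSup {n | ∃ l : List (Form Var), IsAltChain l ∧ (∀ ψ ∈ l, SameCluster φ ψ) ∧ l.length = n}

open Classical in
/-- The global priority map `Ω_g`, undefined (`none`) exactly on the formulas that are not fixpoint
formulas. -/
noncomputable def globalPriority (ψ : Form Var) : Option ℕ :=
  ψ.fixOp?.map fun η =>
    if η.HasParity (closureDepth ψ - hUp ψ) then closureDepth ψ - hUp ψ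
    else closureDepth ψ - hUp ψ + 1

/-- The alternation hierarchy: `Theta η n φ` says that `φ` belongs to the class `Θ^η_n`. -/
inductive Theta : FixOp → ℕ → Form Var → Prop
  | atom {η : FixOp} {φ : Form Var} : IsAtomic φ → Theta η 0 φ
  | and {η : FixOp} {n : ℕ} {φ ψ : Form Var} : Theta η n φ → Theta η n ψ → Theta η n (and φ ψ)
  | or {η : FixOp} {n : ℕ} {φ ψ : Form Var} : Theta η n φ → Theta η n ψ → Theta η n (or φ ψ)
  | dia {η : FixOp} {n : ℕ} {φ : Form Var} : Theta η n φ → Theta η n (dia φ)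
  | box {η : FixOp} {n : ℕ} {φ : Form Var} : Theta η n φ → Theta η n (box φ)
  | fix {η : FixOp} {n : ℕ} {x : Var} {φ : Form Var} :
      φ.PositiveIn x → Theta η n φ → Theta η n (fix η.dual x φ)
  | subst {η : FixOp} {n : ℕ} {x : Var} {φ ψ : Form Var} :
      FreeFor ψ x φ → Theta η n φ → Theta η n ψ → Theta η n (φ.subst x ψ)
  | up {η θ : FixOp} {n : ℕ} {φ : Form Var} : Theta θ n φ → Theta η (n + 1) φ

theorem Theta.mono {η : FixOp} {m n : ℕ} {φ : Form Var} (h : Theta η m φ) (hmn : m ≤ n) :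
    Theta η n φ := by
  induction hmn with
  | refl => exact h
  | step _ ih => exact ih.up

theorem exists_theta {φ : Form Var} (h : φ.WF) : ∃ n, ∀ η, Theta η n φ := by
  induction φ with
  | top | bot | var _ | nvar _ => exact ⟨0, fun _ => .atom trivial⟩
  | and φ ψ ih₁ ih₂ =>
    obtain ⟨m, hm⟩ := ih₁ h.1
    obtain ⟨n, hn⟩ := ih₂ h.2
    exact ⟨max m n, fun η => .and ((hm η).mono (le_max_left _ _)) ((hn η).mono (le_max_right _ _))⟩
  | or φ ψ ih₁ ih₂ =>
    obtain ⟨m, hm⟩ := ih₁ h.1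
    obtain ⟨n, hn⟩ := ih₂ h.2
    exact ⟨max m n, fun η => .or ((hm η).mono (le_max_left _ _)) ((hn η).mono (le_max_right _ _))⟩
  | dia φ ih => obtain ⟨m, hm⟩ := ih h; exact ⟨m, fun η => .dia (hm η)⟩
  | box φ ih => obtain ⟨m, hm⟩ := ih h; exact ⟨m, fun η => .box (hm η)⟩
  | fix θ x φ ih =>
    obtain ⟨m, hm⟩ := ih h.2
    have h' : Theta θ.dual m (Form.fix θ x φ) := by
      have := Theta.fix (η := θ.dual) h.1 (hm _)
      cases θ <;> exact this
    exact ⟨m + 1, fun η => h'.up⟩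

open Classical in
/-- The alternation depth: the least `n` such that the formula belongs to `Θ^μ_n ∩ Θ^ν_n`. -/
noncomputable def alternationDepth (ξ : Form Var) (h : ξ.WF) : ℕ :=
  Nat.find (p := fun n => ∀ η, Theta η n ξ) (exists_theta h)

end Closure

/-- Node labels of parity formulas: atomic formulas, connectives, modalities and `ε`. -/
inductive NodeLabel (Var : Type u) : Type u where
  | top : NodeLabel Var
  | bot : NodeLabel Var
  | pos : Var → NodeLabel Var
  | neg : Var → NodeLabel Var
  | and : NodeLabel Var
  | or : NodeLabel Var
  | dia : NodeLabel Var
  | box : NodeLabel Var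
  | eps : NodeLabel Var

namespace NodeLabel

variable {Var : Type u}

/-- The label is an atomic formula. -/
def IsAtomic : NodeLabel Var → Prop
  | top | bot | pos _ | neg _ => True
  | _ => False

/-- The label is a modality or `ε`. -/
def IsUnary : NodeLabel Var → Prop
  | dia | box | eps => True
  | _ => False

/-- The label uses proposition letters from `P` only. -/
def Over (P : Finset Var) : NodeLabel Var → Prop
  | pos p | neg p => p ∈ P
  | _ => True

end NodeLabel

/-- Parity formulas over a finite set `P` of proposition letters. -/
structure ParityFormula {Var : Type u} (P : Finset Var) where
  /-- nodes -/
  V : Type u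
  finite : Finite V
  /-- edges -/
  E : V → V → Prop
  /-- labelling -/
  L : V → NodeLabel Var
  /-- partial priority map -/
  Ω : V → Option ℕ
  /-- initial node -/
  init : V
  label_over : ∀ v, (L v).Over P
  out_le_two : ∀ v, {w | E v w}.ncard ≤ 2
  out_atomic : ∀ v, (L v).IsAtomic → {w | E v w}.ncard = 0
  out_unary : ∀ v, (L v).IsUnary → {w | E v w}.ncard = 1
  /-- Every cycle passes through a node at which the priority map is defined. -/
  cycle_state : ∀ v, ¬ TransGen (fun u w => E u w ∧ Ω u = none) v v

namespace ParityFormula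

variable {Var : Type u} {P : Finset Var} (G : ParityFormula P)

/-- Two nodes lie in the same cluster if each is reachable from the other. -/
def SameCluster (u v : G.V) : Prop := ReflTransGen G.E u v ∧ ReflTransGen G.E v u

/-- Alternating chains: the priority map is defined on all nodes, and consecutive priorities
increase strictly and have different parity. -/
def IsAltChain (l : List G.V) : Prop :=
  (∀ v ∈ l, (G.Ω v).isSome) ∧
  l.IsChain fun u v => ∃ m n, G.Ω u = some m ∧ G.Ω v = some n ∧ m < n ∧ (Even m ↔ ¬ Even n)

/-- The index of the cluster of `v`: the maximal length of an alternating chain in it. -/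
noncomputable def clusterIndex (v : G.V) : ℕ :=
  sSup {n | ∃ l : List G.V, G.IsAltChain l ∧ (∀ w ∈ l, G.SameCluster v w) ∧ l.length = n}

/-- The index of a parity formula: the maximal index of its clusters. -/
noncomputable def index : ℕ := ⨆ v : G.V, G.clusterIndex v

end ParityFormula

/-! Facts needed to see that the closure graph carries a parity formula. -/

section ClosureFacts

variable {Var : Type u} [DecidableEq Var]

theorem Form.positiveIn_of_notMem {φ : Form Var} (h : φ.WF) {x : Var} (hx : x ∉ φ.FV) :
    φ.PositiveIn x := by
  induction φ with
  | top | bot | var _ => trivial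
  | nvar y => simpa [FV, PositiveIn, eq_comm] using hx
  | and φ ψ ih₁ ih₂ | or φ ψ ih₁ ih₂ =>
    simp only [FV, Finset.mem_union, not_or] at hx
    exact ⟨ih₁ h.1 hx.1, ih₂ h.2 hx.2⟩
  | dia φ ih | box φ ih => exact ih h hx
  | fix θ y φ ih =>
    by_cases hxy : x = y
    · subst hxy; exact h.1
    · exact ih h.2 fun hm => hx (Finset.mem_erase.2 ⟨hxy, hm⟩)

theorem Form.positiveIn_subst {φ τ : Form Var} {x y : Var} (h : φ.PositiveIn y)
    (hτ : τ.PositiveIn y) : (φ.subst x τ).PositiveIn y := by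
  induction φ with
  | top | bot => trivial
  | nvar z => exact h
  | var z => simp only [subst]; split_ifs <;> trivial
  | and φ ψ ih₁ ih₂ | or φ ψ ih₁ ih₂ => exact ⟨ih₁ h.1, ih₂ h.2⟩
  | dia φ ih | box φ ih => exact ih h
  | fix θ z φ ih =>
    simp only [subst]
    split_ifs
    · exact h
    · exact ih h

theorem Form.wf_subst {φ τ : Form Var} {x : Var} (h : φ.WF) (hτ : τ.WF)
    (hd : Disjoint τ.FV φ.BV) : (φ.subst x τ).WF := by
  induction φ with
  | top | bot | nvar _ => trivial
  | var z => simp only [subst]; split_ifs <;> trivial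
  | and φ ψ ih₁ ih₂ | or φ ψ ih₁ ih₂ =>
    simp only [BV, Finset.disjoint_union_right] at hd
    exact ⟨ih₁ h.1 hd.1, ih₂ h.2 hd.2⟩
  | dia φ ih | box φ ih => exact ih h hd
  | fix θ z φ ih =>
    simp only [BV, Finset.disjoint_insert_right] at hd
    simp only [subst]
    split_ifs
    · exact h
    · exact ⟨positiveIn_subst h.1 (positiveIn_of_notMem hτ hd.1), ih h.2 hd.2⟩

theorem Form.fv_subst {φ τ : Form Var} {x : Var} (h : φ.PositiveIn x) :
    (φ.subst x τ).FV ⊆ φ.FV.erase x ∪ τ.FV := by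
  induction φ with
  | top | bot => simp [subst, FV]
  | var z =>
    simp only [subst]
    split_ifs with hz
    · exact Finset.subset_union_right
    · simp [FV, hz]
  | nvar z =>
    have : z ≠ x := h
    simp [subst, FV, this]
  | and φ ψ ih₁ ih₂ | or φ ψ ih₁ ih₂ =>
    intro y hy
    simp only [subst, FV, Finset.mem_union] at hy
    have h₁ := @ih₁ h.1 y
    have h₂ := @ih₂ h.2 y
    simp only [FV, Finset.mem_union, Finset.mem_erase] at h₁ h₂ ⊢
    tauto
  | dia φ ih | box φ ih => exact ih h
  | fix θ z φ ih =>
    intro y hy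
    have h₁ := @ih h y
    simp only [subst] at hy
    split_ifs at hy with hz <;>
    · simp only [FV, Finset.mem_union, Finset.mem_erase] at h₁ hy ⊢
      grind

theorem Form.bv_subst {φ τ : Form Var} {x : Var} : (φ.subst x τ).BV ⊆ φ.BV ∪ τ.BV := by
  induction φ with
  | top | bot | nvar _ => simp [subst, BV]
  | var z =>
    simp only [subst]
    split_ifs with hz <;> simp [BV]
  | and φ ψ ih₁ ih₂ | or φ ψ ih₁ ih₂ =>
    simp only [subst, BV]
    grind
  | dia φ ih | box φ ih => exact ih
  | fix θ z φ ih =>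
    simp only [subst]
    split_ifs with hz <;> simp only [BV] <;> grind

/-- Trace steps preserve tidiness and do not create free variables. -/
theorem Step.tidy {φ ψ : Form Var} (h : Step φ ψ) (hφ : φ.Tidy) : ψ.Tidy ∧ ψ.FV ⊆ φ.FV := by
  obtain ⟨hw, hd⟩ := hφ
  cases h with
  | and_left | or_left =>
    exact ⟨⟨hw.1, hd.mono Finset.subset_union_left Finset.subset_union_left⟩,
      Finset.subset_union_left⟩
  | and_right | or_right =>
    exact ⟨⟨hw.2, hd.mono Finset.subset_union_right Finset.subset_union_right⟩,
      Finset.subset_union_right⟩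
  | dia | box => exact ⟨⟨hw, hd⟩, subset_rfl⟩
  | unfold η x φ =>
    have hF : (φ.subst x (Form.fix η x φ)).FV ⊆ (Form.fix η x φ).FV :=
      (fv_subst hw.1).trans (by simp [FV])
    have hB : (φ.subst x (Form.fix η x φ)).BV ⊆ (Form.fix η x φ).BV :=
      bv_subst.trans (Finset.union_subset (Finset.subset_insert _ _) subset_rfl)
    exact ⟨⟨wf_subst hw.2 hw (hd.mono_right (Finset.subset_insert _ _)), hd.mono hF hB⟩, hF⟩

theorem Reach.tidy {φ ψ : Form Var} (h : Reach φ ψ) (hφ : φ.Tidy) :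
    ψ.Tidy ∧ ψ.FV ⊆ φ.FV := by
  induction h with
  | refl => exact ⟨hφ, subset_rfl⟩
  | tail _ hs ih =>
    have := hs.tidy ih.1
    exact ⟨this.1, this.2.trans ih.2⟩

/-- Simultaneous substitution. -/
def Form.msubst (σ : Var → Form Var) : Form Var → Form Var
  | top => top
  | bot => bot
  | var y => σ y
  | nvar y => nvar y
  | and φ ψ => and (φ.msubst σ) (ψ.msubst σ)
  | or φ ψ => or (φ.msubst σ) (ψ.msubst σ)
  | dia φ => dia (φ.msubst σ)
  | box φ => box (φ.msubst σ)
  | fix η y φ => fix η y (φ.msubst (Function.update σ y (var y)))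

theorem Form.msubst_var (φ : Form Var) : φ.msubst var = φ := by
  induction φ with
  | top | bot | nvar _ | var _ => rfl
  | and φ ψ ih₁ ih₂ | or φ ψ ih₁ ih₂ => simp [msubst, ih₁, ih₂]
  | dia φ ih | box φ ih => simp [msubst, ih]
  | fix θ z φ ih => simp [msubst, ih]

theorem Form.subst_of_notMem {φ τ : Form Var} {x : Var} (h : x ∉ φ.FV) : φ.subst x τ = φ := by
  induction φ with
  | top | bot | nvar _ => rfl
  | var z =>
    have : z ≠ x := by simpa [FV, eq_comm] using h
    simp [subst, this]
  | and φ ψ ih₁ ih₂ | or φ ψ ih₁ ih₂ =>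
    simp only [FV, Finset.mem_union, not_or] at h
    simp [subst, ih₁ h.1, ih₂ h.2]
  | dia φ ih | box φ ih => simp only [subst]; rw [ih h]
  | fix θ z φ ih =>
    simp only [subst]
    split_ifs with hz
    · rfl
    · rw [ih fun hm => h (Finset.mem_erase.2 ⟨Ne.symm hz, hm⟩)]

theorem Form.msubst_congr {φ : Form Var} {σ ρ : Var → Form Var} (h : ∀ y ∈ φ.FV, σ y = ρ y) :
    φ.msubst σ = φ.msubst ρ := by
  induction φ generalizing σ ρ with
  | top | bot | nvar _ => rfl
  | var z => exact h z (by simp [FV])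
  | and φ ψ ih₁ ih₂ | or φ ψ ih₁ ih₂ =>
    simp only [FV, Finset.mem_union] at h
    simp only [msubst]
    rw [ih₁ fun y hy => h y (.inl hy), ih₂ fun y hy => h y (.inr hy)]
  | dia φ ih | box φ ih => simp only [msubst]; rw [ih h]
  | fix θ z φ ih =>
    simp only [msubst]
    rw [ih fun y hy => ?_]
    by_cases hz : y = z
    · simp [hz]
    · simp [hz, h y (Finset.mem_erase.2 ⟨hz, hy⟩)]

theorem Form.subst_msubst {φ τ : Form Var} {x : Var} {σ : Var → Form Var} (hx : σ x = var x)
    (h : ∀ y ∈ φ.FV, y ≠ x → x ∉ (σ y).FV) :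
    (φ.msubst σ).subst x τ = φ.msubst (Function.update σ x τ) := by
  induction φ generalizing σ with
  | top | bot | nvar _ => rfl
  | var z =>
    by_cases hz : z = x
    · subst hz; simp [msubst, hx, subst]
    · simp [msubst, hz, subst_of_notMem (h z (by simp [FV]) hz)]
  | and φ ψ ih₁ ih₂ | or φ ψ ih₁ ih₂ =>
    simp only [FV, Finset.mem_union] at h
    simp only [msubst, subst]
    rw [ih₁ hx fun y hy => h y (.inl hy), ih₂ hx fun y hy => h y (.inr hy)]
  | dia φ ih | box φ ih => simp only [msubst, subst]; rw [ih hx h]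
  | fix θ z φ ih =>
    simp only [msubst, subst]
    split_ifs with hz
    · subst hz; simp
    · rw [ih (by simp [Ne.symm hz, hx]) fun y hy hyx => ?_, Function.update_comm hz]
      by_cases hyz : y = z
      · subst hyz; simpa [FV, eq_comm] using hz
      · simpa [hyz] using h y (Finset.mem_erase.2 ⟨hyz, hy⟩) hyx

theorem Form.fv_msubst {φ : Form Var} {σ : Var → Form Var}
    (hneg : ∀ y, ¬ φ.PositiveIn y → σ y = var y) {z : Var} (hz : z ∈ (φ.msubst σ).FV) :
    ∃ y ∈ φ.FV, z ∈ (σ y).FV := by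
  induction φ generalizing σ with
  | top | bot => simp [msubst, FV] at hz
  | var y => exact ⟨y, by simp [FV], hz⟩
  | nvar y =>
    have hzy : z = y := by simpa [msubst, FV] using hz
    subst hzy
    exact ⟨z, by simp [FV], by rw [hneg z (by simp [PositiveIn])]; simp [FV]⟩
  | and φ ψ ih₁ ih₂ | or φ ψ ih₁ ih₂ =>
    simp only [msubst, FV, Finset.mem_union] at hz ⊢
    rcases hz with hz | hz
    · obtain ⟨y, hy, h⟩ := ih₁ (fun y hy => hneg y fun h => hy h.1) hz
      exact ⟨y, .inl hy, h⟩
    · obtain ⟨y, hy, h⟩ := ih₂ (fun y hy => hneg y fun h => hy h.2) hz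
      exact ⟨y, .inr hy, h⟩
  | dia φ ih | box φ ih => exact ih hneg hz
  | fix θ x φ ih =>
    simp only [msubst, FV, Finset.mem_erase] at hz ⊢
    obtain ⟨y, hy, h⟩ := ih (σ := Function.update σ x (var x)) (fun y hy => by
      by_cases hyx : y = x
      · simp [hyx]
      · simpa [hyx] using hneg y hy) hz.2
    by_cases hyx : y = x
    · subst hyx; simp [FV] at h; exact absurd h hz.1
    · exact ⟨y, ⟨hyx, hy⟩, by simpa [hyx] using h⟩

/-- A finite set containing the closure of `φ.msubst σ` up to what is reachable from the formulas
`σ y`. -/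
theorem exists_finite_closed (φ : Form Var) (σ : Var → Form Var)
    (hw : φ.WF) (hneg : ∀ y, ¬ φ.PositiveIn y → σ y = Form.var y)
    (hd : ∀ y ∈ φ.FV, Disjoint (σ y).FV φ.BV) :
    ∃ S : Set (Form Var), S.Finite ∧ φ.msubst σ ∈ S ∧
      ∀ α ∈ S, ∀ β, Step α β → β ∈ S ∨ ∃ y ∈ φ.FV, Step (σ y) β := by
  induction φ generalizing σ with
  | top | bot | nvar _ => exact ⟨_, Set.finite_singleton _, rfl, by
      rintro α rfl β h; simp only [msubst] at h; cases h⟩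
  | var y => exact ⟨_, Set.finite_singleton _, rfl, by
      rintro α rfl β hs; exact .inr ⟨y, by simp [FV], hs⟩⟩
  | and φ ψ ih₁ ih₂ | or φ ψ ih₁ ih₂ =>
    simp only [FV, BV, Finset.mem_union, Finset.disjoint_union_right] at hd
    obtain ⟨S₁, hf₁, hm₁, hc₁⟩ := ih₁ σ hw.1 (fun y hy => hneg y fun h => hy h.1)
      fun y hy => (hd y (.inl hy)).1
    obtain ⟨S₂, hf₂, hm₂, hc₂⟩ := ih₂ σ hw.2 (fun y hy => hneg y fun h => hy h.2)
      fun y hy => (hd y (.inr hy)).2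
    refine ⟨insert _ (S₁ ∪ S₂), (hf₁.union hf₂).insert _, Set.mem_insert _ _, ?_⟩
    rintro α (rfl | hα | hα) β hs
    · simp only [msubst] at hs
      cases hs
      · exact .inl (.inr (.inl hm₁))
      · exact .inl (.inr (.inr hm₂))
    · rcases hc₁ α hα β hs with h | ⟨y, hy, h⟩
      · exact .inl (.inr (.inl h))
      · exact .inr ⟨y, Finset.mem_union_left _ hy, h⟩
    · rcases hc₂ α hα β hs with h | ⟨y, hy, h⟩
      · exact .inl (.inr (.inr h))
      · exact .inr ⟨y, Finset.mem_union_right _ hy, h⟩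
  | dia φ ih | box φ ih =>
    obtain ⟨S, hf, hm, hc⟩ := ih σ hw hneg hd
    refine ⟨insert _ S, hf.insert _, Set.mem_insert _ _, ?_⟩
    rintro α (rfl | hα) β hs
    · simp only [msubst] at hs
      cases hs
      exact .inl (.inr hm)
    · rcases hc α hα β hs with h | h
      · exact .inl (.inr h)
      · exact .inr h
  | fix θ x φ ih =>
    set τ := (Form.fix θ x φ).msubst σ with hτ
    have hdτ : Disjoint τ.FV φ.BV := by
      rw [Finset.disjoint_left]
      intro z hz hzB
      obtain ⟨y, hy, hzy⟩ := fv_msubst hneg hz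
      exact Finset.disjoint_left.1 (hd y hy) hzy (Finset.mem_insert_of_mem hzB)
    have hstep : ∀ β, Step τ β → β = φ.msubst (Function.update σ x τ) := by
      intro β hs
      rw [hτ] at hs
      simp only [msubst] at hs
      cases hs
      rw [subst_msubst (by simp)]
      · simp [hτ, msubst]
      · intro y hy hyx
        have := hd y (Finset.mem_erase.2 ⟨hyx, hy⟩)
        simpa [hyx] using Finset.disjoint_right.1 this (Finset.mem_insert_self _ _)
    obtain ⟨S, hf, hm, hc⟩ := ih (Function.update σ x τ) hw.2
      (fun y hy => by
        have hyx : y ≠ x := by rintro rfl; exact hy hw.1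
        simpa [hyx] using hneg y hy)
      (fun y hy => by
        by_cases hyx : y = x
        · simpa [hyx] using hdτ
        · simpa [hyx] using
            (hd y (Finset.mem_erase.2 ⟨hyx, hy⟩)).mono_right (Finset.subset_insert _ _))
    refine ⟨insert τ S, hf.insert _, Set.mem_insert _ _, ?_⟩
    rintro α (rfl | hα) β hs
    · rw [hstep β hs]
      exact .inl (.inr hm)
    · rcases hc α hα β hs with h | ⟨y, hy, h⟩
      · exact .inl (.inr h)
      · by_cases hyx : y = x
        · subst hyx
          rw [hstep β (by simpa using h)]
          exact .inl (.inr hm)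
        · exact .inr ⟨y, Finset.mem_erase.2 ⟨hyx, hy⟩, by simpa [hyx] using h⟩

theorem finite_clos {ξ : Form Var} (h : ξ.Tidy) : (Clos ξ).Finite := by
  obtain ⟨S, hf, hm, hc⟩ := exists_finite_closed ξ Form.var h.1 (fun _ _ => rfl)
    (fun y hy => by simpa [FV] using Finset.disjoint_left.1 h.2 hy)
  rw [msubst_var] at hm
  refine hf.subset fun φ hφ => ?_
  induction hφ with
  | refl => exact hm
  | tail _ hs ih =>
    rcases hc _ ih _ hs with h | ⟨y, -, h⟩
    · exact h
    · cases h

/-- The natural labelling of formulas. -/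
def naturalLabel : Form Var → NodeLabel Var
  | .top => .top
  | .bot => .bot
  | .var p => .pos p
  | .nvar p => .neg p
  | .and _ _ => .and
  | .or _ _ => .or
  | .dia _ => .dia
  | .box _ => .box
  | .fix _ _ _ => .eps

/-- Length of a formula. -/
def Form.length : Form Var → ℕ
  | top | bot | var _ | nvar _ => 1
  | and φ ψ => φ.length + ψ.length + 1
  | or φ ψ => φ.length + ψ.length + 1
  | dia φ => φ.length + 1
  | box φ => φ.length + 1
  | fix _ _ φ => φ.length + 1

theorem Step.length_lt {φ ψ : Form Var} (h : Step φ ψ) (hφ : globalPriority φ = none) :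
    ψ.length < φ.length := by
  cases h <;> simp_all [Form.length, globalPriority, fixOp?]

theorem exists_step_pair (φ : Form Var) : ∃ α β, ∀ χ, Step φ χ → χ = α ∨ χ = β := by
  cases φ with
  | top | bot | var _ | nvar _ => exact ⟨.top, .top, by rintro χ ⟨⟩⟩
  | and α β | or α β => exact ⟨α, β, by rintro χ ⟨⟩ <;> simp⟩
  | dia α | box α => exact ⟨α, α, by rintro χ ⟨⟩; simp⟩
  | fix η x α => exact ⟨_, α, by rintro χ ⟨⟩; exact .inl rfl⟩

theorem not_step_of_isAtomic {φ ψ : Form Var} (h : (naturalLabel φ).IsAtomic) : ¬ Step φ ψ := by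
  rintro ⟨⟩ <;> exact h

theorem exists_step_unique {φ : Form Var} (h : (naturalLabel φ).IsUnary) :
    ∃ ψ, ∀ χ, Step φ χ ↔ χ = ψ := by
  cases φ with
  | top | bot | var _ | nvar _ | and _ _ | or _ _ => exact h.elim
  | dia α => exact ⟨α, fun χ => ⟨by rintro ⟨⟩; rfl, by rintro rfl; exact .dia _⟩⟩
  | box α => exact ⟨α, fun χ => ⟨by rintro ⟨⟩; rfl, by rintro rfl; exact .box _⟩⟩
  | fix η x α =>
    exact ⟨_, fun χ => ⟨by rintro ⟨⟩; rfl, by rintro rfl; exact .unfold _ _ _⟩⟩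

/-- The parity formula `G_ξ`: the closure graph of the tidy formula `ξ` with the natural labelling,
the restriction of the global priority map, and initial node `ξ`. -/
noncomputable def closureParityFormula (ξ : Form Var) (h : ξ.Tidy) : ParityFormula ξ.FV where
  V := {φ : Form Var // φ ∈ Clos ξ}
  finite := (finite_clos h).to_subtype
  E φ ψ := Step φ.1 ψ.1
  L φ := naturalLabel φ.1
  Ω φ := globalPriority φ.1
  init := ⟨ξ, ReflTransGen.refl⟩
  label_over := by
    rintro ⟨φ, hφ⟩
    have := (Reach.tidy hφ h).2
    cases φ <;> simp_all [naturalLabel, NodeLabel.Over, FV]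
  out_le_two := by
    rintro ⟨φ, hφ⟩
    obtain ⟨α, β, hs⟩ := exists_step_pair φ
    rw [← Set.ncard_image_of_injective _ Subtype.val_injective]
    refine (Set.ncard_le_ncard (t := {α, β}) ?_ (Set.toFinite _)).trans ?_
    · rintro _ ⟨ψ, hψ, rfl⟩
      exact hs _ hψ
    · exact (Set.ncard_insert_le _ _).trans (by simp)
  out_atomic := by
    rintro ⟨φ, hφ⟩ ha
    have he : {ψ : {φ : Form Var // φ ∈ Clos ξ} | Step φ ψ.1} = ∅ := by
      ext ψ
      simpa using not_step_of_isAtomic ha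
    rw [he, Set.ncard_empty]
  out_unary := by
    rintro ⟨φ, hφ⟩ ha
    obtain ⟨ψ, hs⟩ := exists_step_unique ha
    rw [Set.ncard_eq_one]
    refine ⟨⟨ψ, hφ.tail ((hs ψ).2 rfl)⟩, ?_⟩
    ext χ
    simp [hs, Subtype.ext_iff]
  cycle_state := by
    intro v hv
    have key : ∀ u w : {φ : Form Var // φ ∈ Clos ξ},
        TransGen (fun u w : {φ : Form Var // φ ∈ Clos ξ} =>
          Step u.1 w.1 ∧ globalPriority u.1 = none) u w → w.1.length < u.1.length := by
      intro u w huw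
      induction huw with
      | single h => exact h.1.length_lt h.2
      | tail _ h ih => exact (h.1.length_lt h.2).trans ih
    exact lt_irrefl _ (key v v hv)

end ClosureFacts

end MuCalc

namespace MuCalc

open Form

variable {Var : Type u} [DecidableEq Var]

/-! The bound has two halves: index ≤ closure depth of some cluster, and closure depth ≤ alternation
depth.

For the second half, alternation is measured in the syntax tree by chains of alternating operators,
each depending on the variable of the one above it. A capture-free substitution never joins a chain
of `φ` to a chain of `τ`, so every chain of `φ[τ/x]` already occurs in `φ` or in `τ`. Hence the
closure rules of the alternation hierarchy bound the chains (`Theta.depChain_le`), and unfolding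
along a trace creates no new ones (`Reach.depChain`). A step `φ ⊏_C ψ = ηx.χ` between formulas with
dual operators extends such a chain by one operator. Along the witnessing trace every formula
contains `ψ` freely; replacing `ψ` by a fresh variable `z` leaves a trace, broken only at visits to
`ψ`, where it restarts from `χ[z/x]`. A chain depending on `z` at the end can therefore be pulled
back to a chain depending on `x` in `χ` (`ReachVia.depChainFrom`). So an alternating `⊏_C`-chain of
length `n` yields a dependency chain of `n` operators, and `n` is at most the alternation depth.

For the first half, a shortest formula of a cluster is `⊑_C`-above the whole cluster (`exists_top`).
Maximal alternating chains can thus be taken to end with its operator, so the parity of `hUp ρ` is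
determined by the operator of `ρ`. Consequently `Ω_g` adds the same correction `c` throughout a
cluster (`exists_globalPriority_eq`), and all its priorities lie in an interval with closure-depth
many values. A strictly increasing sequence of priorities is no longer than that. -/

theorem FixOp.dual_dual (η : FixOp) : η.dual.dual = η := by cases η <;> rfl

theorem FixOp.dual_ne (η : FixOp) : η.dual ≠ η := by cases η <;> simp [FixOp.dual]

theorem FixOp.eq_dual_of_ne {η θ : FixOp} (h : η ≠ θ) : η = θ.dual := by
  cases η <;> cases θ <;> simp_all [FixOp.dual]

namespace Form

/-! ### Alternating dependency chains in the syntax tree -/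

/-- Below the free variable `x` of the formula there is an alternating dependency chain of `k + 1`
fixpoint operators whose outermost operator is `η`. An operator depends on a variable if the
variable occurs free in its scope, or occurs free in the scope of an operator on whose variable
it depends. -/
def DepChainFrom : Form Var → Var → FixOp → ℕ → Prop
  | and φ ψ, x, η, k => φ.DepChainFrom x η k ∨ ψ.DepChainFrom x η k
  | or φ ψ, x, η, k => φ.DepChainFrom x η k ∨ ψ.DepChainFrom x η k
  | dia φ, x, η, k => φ.DepChainFrom x η k
  | box φ, x, η, k => φ.DepChainFrom x η k
  | fix θ y φ, x, η, k => x ≠ y ∧ (φ.DepChainFrom x η k ∨ x ∈ φ.FV ∧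
      (φ.DepChainFrom y η k ∨ θ = η ∧ ∀ j, k = j + 1 → φ.DepChainFrom y η.dual j))
  | _, _, _, _ => False

/-- The formula has an alternating dependency chain of `k + 1` fixpoint operators whose outermost
operator is `η`. -/
def DepChain : Form Var → FixOp → ℕ → Prop
  | and φ ψ, η, k => φ.DepChain η k ∨ ψ.DepChain η k
  | or φ ψ, η, k => φ.DepChain η k ∨ ψ.DepChain η k
  | dia φ, η, k => φ.DepChain η k
  | box φ, η, k => φ.DepChain η k
  | fix θ y φ, η, k =>
      φ.DepChain η k ∨ θ = η ∧ ∀ j, k = j + 1 → φ.DepChainFrom y η.dual j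
  | _, _, _ => False

theorem DepChainFrom.mem_fv {φ : Form Var} {x : Var} {η : FixOp} {k : ℕ}
    (h : φ.DepChainFrom x η k) : x ∈ φ.FV := by
  induction φ generalizing η k with
  | top | bot | var _ | nvar _ => exact h.elim
  | and φ ψ ih₁ ih₂ | or φ ψ ih₁ ih₂ =>
    exact Finset.mem_union.2 (h.imp (fun h => ih₁ h) fun h => ih₂ h)
  | dia φ ih | box φ ih => exact ih h
  | fix θ y φ ih =>
    obtain ⟨hxy, h | h⟩ := h
    · exact Finset.mem_erase.2 ⟨hxy, ih h⟩
    · exact Finset.mem_erase.2 ⟨hxy, h.1⟩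

theorem DepChainFrom.depChain {φ : Form Var} {x : Var} {η : FixOp} {k : ℕ}
    (h : φ.DepChainFrom x η k) : φ.DepChain η k := by
  induction φ generalizing x η k with
  | top | bot | var _ | nvar _ => exact h.elim
  | and φ ψ ih₁ ih₂ | or φ ψ ih₁ ih₂ => exact h.imp (fun h => ih₁ h) fun h => ih₂ h
  | dia φ ih | box φ ih => exact ih h
  | fix θ y φ ih =>
    obtain ⟨-, h | ⟨-, h | h⟩⟩ := h
    · exact .inl (ih h)
    · exact .inl (ih h)
    · exact .inr h

theorem noCapture_of_disjoint {φ τ : Form Var} {x : Var} (h : Disjoint τ.FV φ.BV) :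
    φ.NoCapture τ x := by
  induction φ with
  | top | bot | var _ | nvar _ => trivial
  | and φ ψ ih₁ ih₂ | or φ ψ ih₁ ih₂ =>
    simp only [BV, Finset.disjoint_union_right] at h
    exact ⟨ih₁ h.1, ih₂ h.2⟩
  | dia φ ih | box φ ih => exact ih h
  | fix θ y φ ih =>
    simp only [BV, Finset.disjoint_insert_right] at h
    exact .inr ⟨h.1, ih h.2⟩

/-- Operators of `φ` above a substituted `τ` bind no free variable of `τ`, so a chain cannot cross
from `φ` into `τ`. What `τ` can contribute is the link at the top: a chain depending on `x` in `φ`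
comes to depend on the free variables of `τ`, which is the third alternative. -/
theorem DepChainFrom.of_subst {φ τ : Form Var} {x z : Var} {η : FixOp} {k : ℕ}
    (hp : φ.PositiveIn x) (hc : φ.NoCapture τ x) (h : (φ.subst x τ).DepChainFrom z η k) :
    z ≠ x ∧ φ.DepChainFrom z η k ∨ τ.DepChainFrom z η k ∨
      φ.DepChainFrom x η k ∧ z ∈ τ.FV := by
  induction φ generalizing z η k with
  | top | bot | nvar _ => exact h.elim
  | var y =>
    simp only [subst] at h
    split_ifs at h
    · exact .inr (.inl h)
    · exact h.elim
  | and φ ψ ih₁ ih₂ | or φ ψ ih₁ ih₂ =>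
    rcases h with h | h
    · rcases ih₁ hp.1 hc.1 h with h | h | h
      · exact .inl ⟨h.1, .inl h.2⟩
      · exact .inr (.inl h)
      · exact .inr (.inr ⟨.inl h.1, h.2⟩)
    · rcases ih₂ hp.2 hc.2 h with h | h | h
      · exact .inl ⟨h.1, .inr h.2⟩
      · exact .inr (.inl h)
      · exact .inr (.inr ⟨.inr h.1, h.2⟩)
  | dia φ ih | box φ ih => exact ih hp hc h
  | fix θ y φ ih =>
    by_cases hx : x ∈ (fix θ y φ).FV
    · obtain ⟨hxy, hxφ⟩ := Finset.mem_erase.1 hx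
      obtain ⟨hyτ, hcφ⟩ := hc.resolve_left fun h => h hx
      simp only [subst, if_neg (Ne.symm hxy)] at h
      -- Since `y` is not free in `τ`, both alternatives involving `τ` are impossible for chains
      -- depending on `y`.
      have key : ∀ {ζ j}, (φ.subst x τ).DepChainFrom y ζ j → φ.DepChainFrom y ζ j := by
        intro ζ j hj
        rcases ih hp hcφ hj with h | h | h
        · exact h.2
        · exact absurd h.mem_fv hyτ
        · exact absurd h.2 hyτ
      obtain ⟨hzy, h | ⟨hz, h⟩⟩ := h
      · rcases ih hp hcφ h with h | h | h
        · exact .inl ⟨h.1, hzy, .inl h.2⟩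
        · exact .inr (.inl h)
        · exact .inr (.inr ⟨⟨hxy, .inl h.1⟩, h.2⟩)
      · have h' : φ.DepChainFrom y η k ∨ θ = η ∧ ∀ j, k = j + 1 → φ.DepChainFrom y η.dual j :=
          h.imp key (And.imp_right fun h j hj => key (h j hj))
        rcases Finset.mem_union.1 (fv_subst (φ := φ) hp hz) with hz | hz
        · obtain ⟨hzx, hz⟩ := Finset.mem_erase.1 hz
          exact .inl ⟨hzx, hzy, .inr ⟨hz, h'⟩⟩
        · exact .inr (.inr ⟨⟨hxy, .inr ⟨hxφ, h'⟩⟩, hz⟩)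
    · rw [subst_of_notMem hx] at h
      exact .inl ⟨fun e => hx (e ▸ h.mem_fv), h⟩

theorem DepChain.of_subst {φ τ : Form Var} {x : Var} {η : FixOp} {k : ℕ}
    (hp : φ.PositiveIn x) (hc : φ.NoCapture τ x) (h : (φ.subst x τ).DepChain η k) :
    φ.DepChain η k ∨ τ.DepChain η k := by
  induction φ with
  | top | bot | nvar _ => exact h.elim
  | var y =>
    simp only [subst] at h
    split_ifs at h
    · exact .inr h
    · exact h.elim
  | and φ ψ ih₁ ih₂ | or φ ψ ih₁ ih₂ =>
    rcases h with h | h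
    · exact (ih₁ hp.1 hc.1 h).imp_left .inl
    · exact (ih₂ hp.2 hc.2 h).imp_left .inr
  | dia φ ih | box φ ih => exact ih hp hc h
  | fix θ y φ ih =>
    by_cases hx : x ∈ (fix θ y φ).FV
    · obtain ⟨hxy, hxφ⟩ := Finset.mem_erase.1 hx
      obtain ⟨hyτ, hcφ⟩ := hc.resolve_left fun h => h hx
      simp only [subst, if_neg (Ne.symm hxy)] at h
      rcases h with h | ⟨h₁, h₂⟩
      · exact (ih hp hcφ h).imp_left .inl
      · refine .inl (.inr ⟨h₁, fun j hj => ?_⟩)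
        rcases (h₂ j hj).of_subst (φ := φ) hp hcφ with h | h | h
        · exact h.2
        · exact absurd h.mem_fv hyτ
        · exact absurd h.2 hyτ
    · rw [subst_of_notMem hx] at h
      exact .inl h

end Form

/-! ### Dependency chains against the alternation hierarchy and along traces -/

/-- Formulas in `Θ^η_n` have alternating dependency chains of length at most `n + 1`, and of length
at most `n` if the outermost operator is `η`. -/
theorem Theta.depChain_le {η : FixOp} {n : ℕ} {φ : Form Var} (h : Theta η n φ) {θ : FixOp} {k : ℕ}
    (hk : φ.DepChain θ k) : k ≤ n ∧ (θ = η → k < n) := by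
  induction h generalizing θ k with
  | @atom η φ ha => cases φ <;> first | exact hk.elim | exact ha.elim
  | and _ _ ih₁ ih₂ | or _ _ ih₁ ih₂ => exact hk.elim (fun h => ih₁ h) fun h => ih₂ h
  | dia _ ih | box _ ih => exact ih hk
  | @fix η n x φ _ _ ih =>
    rcases hk with hk | ⟨rfl, hk⟩
    · exact ih hk
    · refine ⟨?_, fun h => absurd h η.dual_ne⟩
      cases k with
      | zero => exact Nat.zero_le _
      -- The new operator is `η.dual`, so the remaining chain starts with `η`, and for such chains
      -- the induction hypothesis is strict. This leaves room for the one added operator.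
      | succ j => exact (ih (hk j rfl).depChain).2 η.dual_dual
  | subst hf _ _ ih₁ ih₂ => exact (hk.of_subst hf.1 hf.2).elim (fun h => ih₁ h) fun h => ih₂ h
  | up _ ih => exact ⟨(ih hk).1.trans (Nat.le_succ _), fun _ => Nat.lt_succ_of_le (ih hk).1⟩

theorem noCapture_unfold {η : FixOp} {x : Var} {φ : Form Var} (h : (Form.fix η x φ).Tidy) :
    φ.NoCapture (Form.fix η x φ) x :=
  noCapture_of_disjoint (h.2.mono_right (Finset.subset_insert _ _))

theorem Step.depChain {φ ψ : Form Var} (hs : Step φ ψ) (hφ : φ.Tidy) {η : FixOp} {k : ℕ}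
    (h : ψ.DepChain η k) : φ.DepChain η k := by
  cases hs with
  | and_left | or_left => exact .inl h
  | and_right | or_right => exact .inr h
  | dia | box => exact h
  | unfold θ x φ => exact (h.of_subst hφ.1.1 (noCapture_unfold hφ)).elim .inl id

theorem Reach.depChain {φ ψ : Form Var} (hr : Reach φ ψ) (hφ : φ.Tidy) {η : FixOp} {k : ℕ}
    (h : ψ.DepChain η k) : φ.DepChain η k := by
  induction hr using ReflTransGen.head_induction_on with
  | refl => exact h
  | head hs _ ih => exact hs.depChain hφ (ih (hs.tidy hφ).1)

/-- When a fixpoint formula is unfolded, a chain depending on `z` may run through the inserted copy.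
It then depends on the unfolded variable, and the outer operator already links that variable to `z`.
-/
theorem Step.depChainFrom {φ ψ : Form Var} (hs : Step φ ψ) (hφ : φ.Tidy) {z : Var} {η : FixOp}
    {k : ℕ} (h : ψ.DepChainFrom z η k) : φ.DepChainFrom z η k := by
  cases hs with
  | and_left | or_left => exact .inl h
  | and_right | or_right => exact .inr h
  | dia | box => exact h
  | unfold θ x φ =>
    rcases h.of_subst hφ.1.1 (noCapture_unfold hφ) with h | h | h
    · exact ⟨h.1, .inl h.2⟩
    · exact h
    · obtain ⟨hzx, hz⟩ := Finset.mem_erase.1 h.2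
      exact ⟨hzx, .inr ⟨hz, .inl h.1⟩⟩

namespace Form

/-! ### Abstracting a subformula by a variable -/

open Classical in
/-- `abstr ψ z ρ` replaces all occurrences of the formula `ψ` in `ρ` by the variable `z`. -/
noncomputable def abstr (ψ : Form Var) (z : Var) : Form Var → Form Var
  | top => if top = ψ then var z else top
  | bot => if bot = ψ then var z else bot
  | var y => if var y = ψ then var z else var y
  | nvar y => if nvar y = ψ then var z else nvar y
  | and α β => if and α β = ψ then var z else and (abstr ψ z α) (abstr ψ z β)
  | or α β => if or α β = ψ then var z else or (abstr ψ z α) (abstr ψ z β)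
  | dia α => if dia α = ψ then var z else dia (abstr ψ z α)
  | box α => if box α = ψ then var z else box (abstr ψ z α)
  | fix η y α => if fix η y α = ψ then var z else fix η y (abstr ψ z α)

omit [DecidableEq Var] in
theorem abstr_self (ψ : Form Var) (z : Var) : abstr ψ z ψ = var z := by
  cases ψ <;> simp [abstr]

theorem fv_abstr (ψ : Form Var) (z : Var) (ρ : Form Var) :
    (abstr ψ z ρ).FV ⊆ insert z ρ.FV := by
  induction ρ <;> simp only [abstr] <;> split_ifs <;> simp only [FV] at * <;> grind

theorem bv_abstr (ψ : Form Var) (z : Var) (ρ : Form Var) : (abstr ψ z ρ).BV ⊆ ρ.BV := by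
  induction ρ <;> simp only [abstr] <;> split_ifs <;> simp only [BV] at * <;> grind

omit [DecidableEq Var] in
theorem PositiveIn.abstr {ψ : Form Var} {z w : Var} {ρ : Form Var} (h : ρ.PositiveIn w) :
    (abstr ψ z ρ).PositiveIn w := by
  induction ρ <;> simp only [Form.abstr] <;> split_ifs <;> simp_all [PositiveIn]

omit [DecidableEq Var] in
theorem WF.abstr {ψ : Form Var} {z : Var} {ρ : Form Var} (h : ρ.WF) : (abstr ψ z ρ).WF := by
  induction ρ <;> simp only [Form.abstr] <;> split_ifs <;> simp_all [WF, PositiveIn.abstr]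

theorem Tidy.abstr {ψ : Form Var} {z : Var} {ρ : Form Var} (h : ρ.Tidy) (hz : z ∉ ρ.BV) :
    (abstr ψ z ρ).Tidy := by
  refine ⟨h.1.abstr, Disjoint.mono (fv_abstr ψ z ρ) (bv_abstr ψ z ρ) ?_⟩
  exact Finset.disjoint_insert_left.2 ⟨hz, h.2⟩

theorem subst_abstr {ψ : Form Var} {z : Var} {ρ : Form Var} (hf : z ∉ ρ.FV) (hb : z ∉ ρ.BV) :
    (abstr ψ z ρ).subst z ψ = ρ := by
  induction ρ <;> simp only [abstr] <;> split_ifs with h <;>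
    first
    | (simp [subst, h]; done)
    | (simp only [FV, BV] at hf hb; simp only [subst]; grind)

omit [DecidableEq Var] in
theorem abstr_of_length_lt {ψ : Form Var} {z : Var} {ρ : Form Var} (h : ρ.length < ψ.length) :
    abstr ψ z ρ = ρ := by
  induction ρ <;>
    (rw [abstr, if_neg (by rintro rfl; exact lt_irrefl _ h)]; try (simp only [length] at h; grind))

/-- Substituting `τ` changes nothing, or happens at the root, or creates a formula longer than
`τ`. -/
theorem subst_trichotomy (φ : Form Var) (x : Var) (τ : Form Var) :
    φ.subst x τ = φ ∨ φ = var x ∨ τ.length < (φ.subst x τ).length := by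
  induction φ <;> simp only [subst, length] <;> grind [subst, length]

theorem length_lt_subst {φ : Form Var} {x : Var} (hx : x ∈ φ.FV) (hp : φ.PositiveIn x)
    (τ : Form Var) : φ = var x ∨ τ.length < (φ.subst x τ).length := by
  induction φ <;> simp only [FV, PositiveIn] at hx hp <;> simp only [subst, length] <;>
    grind [subst, length]

theorem subst_eq_iff {φ ψ τ : Form Var} {x : Var} (hx : x ∉ ψ.FV) (hl : ψ.length ≤ τ.length)
    (hφ : φ ≠ var x) : φ.subst x τ = ψ ↔ φ = ψ := by
  constructor
  · intro h
    rcases subst_trichotomy φ x τ with h' | h' | h'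
    · exact h'.symm.trans h
    · exact absurd h' hφ
    · rw [h] at h'; omega
  · rintro rfl
    exact subst_of_notMem hx

/-- Any formula other than `var x` into which `τ` is really substituted becomes longer than `τ`,
hence longer than `ψ`. So substitution neither creates nor destroys occurrences of `ψ` outside the
copies of `τ`. -/
theorem abstr_subst {ψ τ : Form Var} {x z : Var} (hx : x ∉ ψ.FV) (hl : ψ.length ≤ τ.length)
    (hz : z ≠ x) (φ : Form Var) :
    abstr ψ z (φ.subst x τ) = (abstr ψ z φ).subst x (abstr ψ z τ) := by
  have key : ∀ {φ : Form Var}, φ ≠ var x → φ ≠ ψ → φ.subst x τ ≠ ψ :=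
    fun h => mt (subst_eq_iff hx hl h).1
  have triv : abstr ψ z (ψ.subst x τ) = (abstr ψ z ψ).subst x (abstr ψ z τ) := by
    rw [subst_of_notMem hx, abstr_self]; simp [subst, hz]
  induction φ with
  | top | bot | nvar _ => simp only [subst, abstr]; split_ifs <;> simp [subst, hz]
  | var y =>
    by_cases hy : y = x
    · subst hy
      have : var y ≠ ψ := by rintro rfl; simp [FV] at hx
      simp [subst, abstr, this]
    · simp only [subst, if_neg hy, abstr]
      split_ifs <;> simp [subst, hz, hy]
  | and α β ih₁ ih₂ =>
    by_cases he : and α β = ψ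
    · exact he ▸ triv
    · have hne := key (by simp) he
      simp only [subst] at hne ⊢
      simp only [abstr, if_neg hne, if_neg he, subst, ih₁, ih₂]
  | or α β ih₁ ih₂ =>
    by_cases he : or α β = ψ
    · exact he ▸ triv
    · have hne := key (by simp) he
      simp only [subst] at hne ⊢
      simp only [abstr, if_neg hne, if_neg he, subst, ih₁, ih₂]
  | dia α ih =>
    by_cases he : dia α = ψ
    · exact he ▸ triv
    · have hne := key (by simp) he
      simp only [subst] at hne ⊢
      simp only [abstr, if_neg hne, if_neg he, subst, ih]
  | box α ih =>
    by_cases he : box α = ψ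
    · exact he ▸ triv
    · have hne := key (by simp) he
      simp only [subst] at hne ⊢
      simp only [abstr, if_neg hne, if_neg he, subst, ih]
  | fix θ y α ih =>
    by_cases he : fix θ y α = ψ
    · exact he ▸ triv
    · have hne := key (by simp) he
      simp only [subst] at hne ⊢
      split_ifs at hne ⊢ with hy
      · simp only [abstr, if_neg he, subst, if_pos hy]
      · simp only [abstr, if_neg he, if_neg hne, subst, if_neg hy, ih]

/-- For `φ` shorter than `ψ`, the only occurrences of `ψ` in `φ[ψ/x]` are the substituted ones. This
covers the unfolding of `ψ` itself, where abstraction does not commute with the step. -/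
theorem abstr_subst_self {ψ φ : Form Var} {x z : Var} (h : φ.length < ψ.length) :
    abstr ψ z (φ.subst x ψ) = φ.subst x (var z) := by
  have key : ∀ φ : Form Var, φ.length < ψ.length → φ ≠ var x → φ.subst x ψ ≠ ψ := by
    intro φ h hφ he
    rcases subst_trichotomy φ x ψ with h' | h' | h'
    · rw [← h', he] at h; exact lt_irrefl _ h
    · exact hφ h'
    · rw [he] at h'; exact lt_irrefl _ h'
  induction φ with
  | top | bot | nvar _ => exact abstr_of_length_lt h
  | var y =>
    by_cases hy : y = x
    · simp [subst, hy, abstr_self]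
    · simpa only [subst, if_neg hy] using abstr_of_length_lt h
  | and α β ih₁ ih₂ | or α β ih₁ ih₂ =>
    have hne := key _ h (by simp)
    simp only [length] at h
    simp only [subst] at hne ⊢
    rw [abstr, if_neg hne, ih₁ (by omega), ih₂ (by omega)]
  | dia α ih | box α ih =>
    have hne := key _ h (by simp)
    simp only [length] at h
    simp only [subst] at hne ⊢
    rw [abstr, if_neg hne, ih (by omega)]
  | fix θ y α ih =>
    have hne := key _ h (by simp)
    simp only [subst] at hne ⊢
    split_ifs at hne ⊢ with hy
    · exact abstr_of_length_lt h
    · simp only [length] at h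
      rw [abstr, if_neg hne, ih (by omega)]

/-! ### Free subformulas -/

theorem fv_subset_subst {φ τ : Form Var} {x : Var} (hx : x ∈ φ.FV) (hp : φ.PositiveIn x)
    (hc : φ.NoCapture τ x) : τ.FV ⊆ (φ.subst x τ).FV := by
  induction φ with
  | top | bot => simp [FV] at hx
  | nvar y => exact absurd (Finset.mem_singleton.1 hx).symm hp
  | var y => simp [subst, (Finset.mem_singleton.1 hx).symm]
  | and φ ψ ih₁ ih₂ | or φ ψ ih₁ ih₂ =>
    rcases Finset.mem_union.1 hx with hx | hx
    · exact (ih₁ hx hp.1 hc.1).trans Finset.subset_union_left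
    · exact (ih₂ hx hp.2 hc.2).trans Finset.subset_union_right
  | dia φ ih | box φ ih => exact ih hx hp hc
  | fix θ y φ ih =>
    obtain ⟨hyτ, hc⟩ := hc.resolve_left fun h => h hx
    obtain ⟨hxy, hx⟩ := Finset.mem_erase.1 hx
    simp only [subst, if_neg hxy.symm]
    exact fun w hw => Finset.mem_erase.2 ⟨fun e => hyτ (e ▸ hw), ih hx hp hc hw⟩

theorem FreeSub.fv_subset {φ ψ : Form Var} (h : FreeSub φ ψ) : φ.FV ⊆ ψ.FV := by
  obtain ⟨α, x, -, hx, hf, rfl⟩ := h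
  exact fv_subset_subst hx hf.1 hf.2

theorem FreeSub.eq_or_length_lt {φ ψ : Form Var} (h : FreeSub φ ψ) :
    φ = ψ ∨ φ.length < ψ.length := by
  obtain ⟨α, x, -, hx, hf, rfl⟩ := h
  exact (length_lt_subst hx hf.1 φ).imp_left fun h => by simp [h, subst]

theorem FreeSub.length_le {φ ψ : Form Var} (h : FreeSub φ ψ) : φ.length ≤ ψ.length := by
  rcases h.eq_or_length_lt with rfl | h
  · exact le_rfl
  · exact h.le

theorem FreeSub.antisymm {φ ψ : Form Var} (h₁ : FreeSub φ ψ) (h₂ : FreeSub ψ φ) : φ = ψ :=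
  h₁.eq_or_length_lt.resolve_right h₂.length_le.not_gt

theorem FreeSub.refl [Nonempty Var] (φ : Form Var) : FreeSub φ φ :=
  ⟨var (Classical.arbitrary Var), _, trivial, Finset.mem_singleton_self _, ⟨trivial, trivial⟩,
    by simp [subst]⟩

/-- With `freeSub_of_mem_fv_abstr` this turns being a free subformula into a condition on free
variables, which can be followed along traces. -/
theorem FreeSub.mem_fv_abstr {ψ ρ : Form Var} (h : FreeSub ψ ρ) {z : Var} (hz : z ∉ ρ.BV) :
    z ∈ (abstr ψ z ρ).FV := by
  obtain ⟨α, x, -, hx, ⟨hp, -⟩, rfl⟩ := h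
  induction α with
  | top | bot => simp [FV] at hx
  | nvar y => exact absurd (Finset.mem_singleton.1 hx).symm hp
  | var y =>
    rw [Finset.mem_singleton.1 hx]
    simp [subst, abstr_self, FV]
  | and φ χ ih₁ ih₂ | or φ χ ih₁ ih₂ =>
    simp only [subst, BV, Finset.mem_union, not_or] at hz
    simp only [subst, abstr]
    split_ifs
    · simp [FV]
    · exact Finset.mem_union.2 ((Finset.mem_union.1 hx).imp (fun hx => ih₁ hx hp.1 hz.1)
        fun hx => ih₂ hx hp.2 hz.2)
  | dia φ ih | box φ ih =>
    simp only [subst, abstr]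
    split_ifs
    · simp [FV]
    · exact ih hx hp hz
  | fix θ y φ ih =>
    obtain ⟨hxy, hx⟩ := Finset.mem_erase.1 hx
    simp only [subst, if_neg hxy.symm, BV, Finset.mem_insert, not_or] at hz
    simp only [subst, if_neg hxy.symm, abstr]
    split_ifs
    · simp [FV]
    · exact Finset.mem_erase.2 ⟨hz.1, ih hx hp hz.2⟩

theorem freeSub_of_mem_fv_abstr {ψ ρ : Form Var} {z : Var} (hρ : ρ.WF)
    (hf : z ∉ ρ.FV) (hb : z ∉ ρ.BV) (hd : Disjoint ψ.FV ρ.BV) (h : z ∈ (abstr ψ z ρ).FV) :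
    FreeSub ψ ρ :=
  ⟨abstr ψ z ρ, z, hρ.abstr, h, ⟨(positiveIn_of_notMem hρ hf).abstr,
    noCapture_of_disjoint (hd.mono_right (bv_abstr ψ z ρ))⟩, (subst_abstr hf hb).symm⟩

end Form

/-! ### Free subformulas are reachable -/

/-- Simultaneous substitutions make the induction pass through binders: unfolding an instance of
`θy.φ` yields the instance of `φ` under `σ` extended by sending `y` to the whole fixpoint formula.
-/
theorem reach_msubst {φ : Form Var} {σ : Var → Form Var} {x : Var}
    (hw : φ.WF) (hneg : ∀ y, ¬ φ.PositiveIn y → σ y = Form.var y)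
    (hd : ∀ y ∈ φ.FV, Disjoint (σ y).FV φ.BV) (hx : x ∈ φ.FV) (hp : φ.PositiveIn x) :
    Reach (φ.msubst σ) (σ x) := by
  induction φ generalizing σ with
  | top | bot => simp [FV] at hx
  | nvar y => exact absurd (Finset.mem_singleton.1 hx).symm hp
  | var y =>
    obtain rfl := Finset.mem_singleton.1 hx
    exact ReflTransGen.refl
  | and φ ψ ih₁ ih₂ | or φ ψ ih₁ ih₂ =>
    simp only [FV, BV, Finset.mem_union, Finset.disjoint_union_right] at hd
    rcases Finset.mem_union.1 hx with hx | hx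
    · exact (ih₁ hw.1 (fun y hy => hneg y fun h => hy h.1) (fun y hy => (hd y (.inl hy)).1)
        hx hp.1).head (by constructor)
    · exact (ih₂ hw.2 (fun y hy => hneg y fun h => hy h.2) (fun y hy => (hd y (.inr hy)).2)
        hx hp.2).head (by constructor)
  | dia φ ih | box φ ih => exact (ih hw hneg hd hx hp).head (by constructor)
  | fix θ y φ ih =>
    obtain ⟨hxy, hxφ⟩ := Finset.mem_erase.1 hx
    set τ := (Form.fix θ y φ).msubst σ with hτ
    have hstep : Step τ (φ.msubst (Function.update σ y τ)) := by
      have h := Step.unfold θ y (φ.msubst (Function.update σ y (Form.var y)))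
      rw [subst_msubst (by simp)] at h
      · simpa [hτ, msubst] using h
      · intro w hw hwy
        have := hd w (Finset.mem_erase.2 ⟨hwy, hw⟩)
        simpa [hwy] using Finset.disjoint_right.1 this (Finset.mem_insert_self _ _)
    have hr := ih (σ := Function.update σ y τ) hw.2
      (fun w hwn => by
        have hwy : w ≠ y := by rintro rfl; exact hwn hw.1
        simpa [hwy] using hneg w hwn)
      (fun w hwφ => by
        by_cases hwy : w = y
        · rw [hwy, Function.update_self, Finset.disjoint_left]
          intro v hv hvB
          obtain ⟨u, hu, hvu⟩ := fv_msubst hneg hv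
          exact Finset.disjoint_left.1 (hd u hu) hvu (Finset.mem_insert_of_mem hvB)
        · simpa [hwy] using
            (hd w (Finset.mem_erase.2 ⟨hwy, hwφ⟩)).mono_right (Finset.subset_insert _ _))
      hxφ hp
    rw [Function.update_of_ne hxy] at hr
    exact hr.head hstep

/-- A tidy formula reaches its free subformulas. -/
theorem Form.FreeSub.reach [Infinite Var] {ψ ρ : Form Var} (h : FreeSub ψ ρ) (hρ : ρ.Tidy) :
    Reach ρ ψ := by
  obtain ⟨z, hz⟩ := Infinite.exists_notMem_finset (ρ.FV ∪ ρ.BV)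
  obtain ⟨hf, hb⟩ := not_or.1 (mt Finset.mem_union.2 hz)
  have hp := (positiveIn_of_notMem hρ.1 hf).abstr (ψ := ψ) (z := z)
  have hr := reach_msubst (σ := Function.update Form.var z ψ) (hρ.1.abstr (ψ := ψ) (z := z))
    (fun y hy => by
      have : y ≠ z := by rintro rfl; exact hy hp
      simp [this])
    (fun y hy => by
      refine Disjoint.mono_right (bv_abstr ψ z ρ) ?_
      by_cases hyz : y = z
      · simpa [hyz] using hρ.2.mono_left h.fv_subset
      · have := (Finset.mem_insert.1 (fv_abstr ψ z ρ hy)).resolve_left hyz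
        simpa [hyz, FV] using Finset.disjoint_left.1 hρ.2 this)
    (h.mem_fv_abstr hb) hp
  rw [← subst_msubst (σ := Form.var) rfl (by simp [FV, eq_comm]), msubst_var,
    subst_abstr hf hb] at hr
  simpa using hr

/-! ### Chains of the closure priority relation -/

theorem Step.bv_subset {φ ψ : Form Var} (h : Step φ ψ) : ψ.BV ⊆ φ.BV := by
  cases h with
  | and_left | or_left => exact Finset.subset_union_left
  | and_right | or_right => exact Finset.subset_union_right
  | dia | box => exact subset_rfl
  | unfold η x φ =>
    exact bv_subst.trans (Finset.union_subset (Finset.subset_insert _ _) subset_rfl)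

/-- Abstraction commutes with trace steps that do not start at the abstracted formula. -/
theorem Step.abstr {ψ ρ σ : Form Var} {z : Var} (hs : Step ρ σ) (hne : ρ ≠ ψ)
    (hl : ψ.length ≤ ρ.length) (hd : Disjoint ψ.FV ρ.BV) (hz : z ∉ ρ.BV) :
    Step (abstr ψ z ρ) (abstr ψ z σ) := by
  cases hs with
  | and_left | and_right | or_left | or_right | dia | box =>
    simp only [Form.abstr, if_neg hne]
    constructor
  | unfold θ y γ =>
    simp only [BV, Finset.disjoint_insert_right, Finset.mem_insert, not_or] at hd hz
    rw [abstr_subst hd.1 hl hz.1]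
    simp only [Form.abstr, if_neg hne]
    exact .unfold _ _ _

omit [DecidableEq Var] in
theorem isFix_iff {φ : Form Var} : IsFix φ ↔ ∃ η x χ, φ = Form.fix η x χ := by
  cases φ <;> simp [IsFix, fixOp?]

theorem ReachVia.freeSub {ψ ρ σ : Form Var} (h : ReachVia ψ ρ σ) : FreeSub ψ σ := by
  rcases h.2.cases_tail with rfl | ⟨_, _, h⟩
  exacts [h.1, h.2]

theorem ReachVia.reach {ψ ρ σ : Form Var} (h : ReachVia ψ ρ σ) : Reach ρ σ :=
  h.2.lift id fun _ _ h => h.1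

/-- Along a trace below `ψ = ηx.χ`, dependency chains at the end of the trace give rise to
dependency chains in `χ` that depend on `x`. -/
theorem ReachVia.depChainFrom [Infinite Var] {η θ : FixOp} {x y : Var} {χ φ : Form Var} {k : ℕ}
    (hψ : (Form.fix η x χ).Tidy)
    (h : ReachVia (Form.fix η x χ) (Form.fix η x χ) (Form.fix θ y φ))
    (hne : Form.fix θ y φ ≠ Form.fix η x χ)
    (hk : ∀ j, k = j + 1 → φ.DepChainFrom y θ.dual j) : χ.DepChainFrom x θ k := by
  set ψ := Form.fix η x χ with hψ'
  obtain ⟨z, hz⟩ := Infinite.exists_notMem_finset (ψ.FV ∪ ψ.BV)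
  obtain ⟨hzf, hzb⟩ := not_or.1 (mt Finset.mem_union.2 hz)
  have hzx : z ≠ x := fun e => hzb (Finset.mem_insert.2 (.inl e))
  have hzχ : z ∉ χ.FV := fun hm => hzf (Finset.mem_erase.2 ⟨hzx, hm⟩)
  have inv : ∀ {σ}, ReachVia ψ ψ σ →
      σ.Tidy ∧ z ∉ σ.FV ∧ z ∉ σ.BV ∧ Disjoint ψ.FV σ.BV := by
    intro σ hσ
    obtain ⟨ht, hF⟩ := hσ.reach.tidy hψ
    have hB : σ.BV ⊆ ψ.BV := by
      have := hσ.reach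
      clear hσ ht hF
      induction this with
      | refl => exact subset_rfl
      | tail _ hs ih => exact hs.bv_subset.trans ih
    exact ⟨ht, fun hm => hzf (hF hm), fun hm => hzb (hB hm), hψ.2.mono_right hB⟩
  -- After unfolding `ψ`, the abstracted formula is `χ[z/x]`. Since `z` does not occur in `χ`, a
  -- chain depending on `z` comes from one depending on `x`.
  have start : (abstr ψ z (χ.subst x ψ)).DepChainFrom z θ k → χ.DepChainFrom x θ k := by
    intro hc
    rw [abstr_subst_self (by simp [hψ', Form.length])] at hc
    have hzB : z ∉ χ.BV := fun hm => hzb (Finset.mem_insert_of_mem hm)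
    rcases hc.of_subst hψ.1.1
      (noCapture_of_disjoint (by simpa [FV] using hzB)) with hc | hc | hc
    · exact absurd hc.2.mem_fv hzχ
    · exact hc.elim
    · exact hc.1
  -- The chain is pulled back along the abstracted trace until the latest visit to `ψ`, where
  -- `start` applies.
  have back : ∀ {σ}, ReachVia ψ ψ σ → (abstr ψ z σ).DepChainFrom z θ k →
      χ.DepChainFrom x θ k := by
    rintro σ ⟨h₀, hσ⟩ hc
    induction hσ with
    | refl => rw [abstr_self] at hc; exact hc.elim
    | @tail ρ σ hρ hs ih =>
      have hvia : ReachVia ψ ψ ρ := ⟨h₀, hρ⟩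
      obtain ⟨ht, -, hb, hd⟩ := inv hvia
      by_cases he : ρ = ψ
      · rw [he] at hs
        obtain ⟨hs, -⟩ := hs
        rw [hψ'] at hs
        cases hs
        exact start hc
      · exact ih ((hs.1.abstr he hvia.freeSub.length_le hd hb).depChainFrom (ht.abstr hb) hc)
  obtain ⟨ht, hf, hb, hd⟩ := inv h
  refine back h ?_
  -- In the abstracted end formula the operator `θy` has `z` free in its scope, so it heads a chain
  -- depending on `z`. The chain below `y` survives abstraction because `y` is not free in `ψ`.
  have hmem := h.freeSub.mem_fv_abstr hb
  simp only [abstr, if_neg hne] at hmem ⊢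
  obtain ⟨hzy, hzφ⟩ := Finset.mem_erase.1 hmem
  refine ⟨hzy, .inr ⟨hzφ, .inr ⟨rfl, fun j hj => ?_⟩⟩⟩
  simp only [BV, Finset.disjoint_insert_right, Finset.mem_insert, not_or] at hb hd
  have hzφ' : z ∉ φ.FV := fun hm => hf (Finset.mem_erase.2 ⟨hzy, hm⟩)
  have hc := hk j hj
  rw [← subst_abstr (ψ := ψ) hzφ' hb.2] at hc
  rcases hc.of_subst (positiveIn_of_notMem ht.1.2 hzφ').abstr
    (noCapture_of_disjoint (hd.2.mono_right (bv_abstr ψ z φ))) with hc | hc | hc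
  · exact hc.2
  · exact absurd hc.mem_fv hd.1
  · exact absurd hc.2 hd.1

theorem isAltChain_cons_cons {φ ψ : Form Var} {l : List (Form Var)} :
    IsAltChain (φ :: ψ :: l) ↔ (Tidy φ ∧ IsFix φ) ∧
      (ClosLT φ ψ ∧ ψ.fixOp? = φ.fixOp?.map FixOp.dual) ∧ IsAltChain (ψ :: l) := by
  simp only [IsAltChain, List.isChain_cons_cons, List.forall_mem_cons]
  tauto

theorem isAltChain_singleton {φ : Form Var} : IsAltChain [φ] ↔ Tidy φ ∧ IsFix φ := by
  simp [IsAltChain]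

theorem IsAltChain.head {φ : Form Var} {l : List (Form Var)} (h : IsAltChain (φ :: l)) :
    Tidy φ ∧ IsFix φ := h.1 φ List.mem_cons_self

/-- The number `k` counts the operators already gathered below the current formula. Each step along
the list adds one by `ReachVia.depChainFrom`, and the formula found is the last of the list. -/
theorem IsAltChain.exists_depChain [Infinite Var] {l : List (Form Var)} {θ : FixOp} {y : Var}
    {φ : Form Var} {k : ℕ} (h : IsAltChain (Form.fix θ y φ :: l))
    (hk : ∀ j, k = j + 1 → φ.DepChainFrom y θ.dual j) :
    ∃ ψ ∈ Form.fix θ y φ :: l, ∃ η, ψ.DepChain η (k + l.length) := by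
  induction l generalizing θ y φ k with
  | nil => exact ⟨_, List.mem_cons_self, θ, .inr ⟨rfl, hk⟩⟩
  | cons ψ l ih =>
    obtain ⟨-, ⟨hlt, hop⟩, hl⟩ := isAltChain_cons_cons.1 h
    obtain ⟨η, x, χ, rfl⟩ := isFix_iff.1 hl.head.2
    obtain rfl : η = θ.dual := by simpa [fixOp?] using hop
    have hc := hlt.1.2.2.depChainFrom hl.head.1 (by simp [θ.dual_ne.symm]) hk
    obtain ⟨ρ, hρ, ζ, hζ⟩ := ih (k := k + 1) hl fun j hj => by
      obtain rfl : k = j := by omega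
      rwa [θ.dual_dual]
    refine ⟨ρ, List.mem_cons_of_mem _ hρ, ζ, ?_⟩
    rwa [List.length_cons, Nat.add_comm l.length 1, ← Nat.add_assoc]

/-- Alternating chains in the closure of `ξ` are no longer than the alternation depth of `ξ`. -/
theorem IsAltChain.length_le_alternationDepth [Infinite Var] {ξ : Form Var} (hξ : ξ.Tidy)
    {l : List (Form Var)} (h : IsAltChain l) (hl : ∀ φ ∈ l, Reach ξ φ) :
    l.length ≤ alternationDepth ξ hξ.1 := by
  cases l with
  | nil => exact Nat.zero_le _
  | cons φ l =>
    obtain ⟨θ, y, φ, rfl⟩ := isFix_iff.1 h.head.2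
    obtain ⟨ψ, hψ, η, hc⟩ := h.exists_depChain (k := 0) (by simp)
    classical
    have hθ : ∀ η, Theta η (alternationDepth ξ hξ.1) ξ := Nat.find_spec (exists_theta hξ.1)
    -- Choosing the class whose superscript is the outermost operator of the chain gives the strict
    -- bound, which absorbs the offset between `k` and the `k + 1` operators.
    have := ((hθ η).depChain_le ((hl ψ hψ).depChain hξ hc)).2 rfl
    simp only [List.length_cons]
    omega

/-! ### Heights of chains and closure depth of clusters -/

theorem ClosLE.antisymm {φ ψ : Form Var} (h₁ : ClosLE φ ψ) (h₂ : ClosLE ψ φ) : φ = ψ :=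
  h₂.2.2.freeSub.antisymm h₁.2.2.freeSub

/-- The larger formula is a proper free subformula of the smaller one. Formula length therefore
bounds alternating chains. -/
theorem ClosLT.length_lt {φ ψ : Form Var} (h : ClosLT φ ψ) : ψ.length < φ.length :=
  h.1.2.2.freeSub.eq_or_length_lt.resolve_left fun e => h.2 (by obtain rfl := e; exact h.1)

theorem ClosLT.sameCluster [Infinite Var] {φ ψ : Form Var} (h : ClosLT φ ψ) (hφ : φ.Tidy) :
    SameCluster φ ψ := ⟨h.1.2.2.freeSub.reach hφ, h.1.2.2.reach⟩

theorem SameCluster.refl (φ : Form Var) : SameCluster φ φ := ⟨.refl, .refl⟩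

theorem SameCluster.symm {φ ψ : Form Var} (h : SameCluster φ ψ) : SameCluster ψ φ := ⟨h.2, h.1⟩

theorem SameCluster.trans {φ ψ χ : Form Var} (h₁ : SameCluster φ ψ) (h₂ : SameCluster ψ χ) :
    SameCluster φ χ := ⟨ReflTransGen.trans h₁.1 h₂.1, ReflTransGen.trans h₂.2 h₁.2⟩

theorem IsAltChain.length_lt {φ : Form Var} {l : List (Form Var)} (h : IsAltChain (φ :: l)) :
    l.length < φ.length := by
  induction l generalizing φ with
  | nil => cases φ <;> simp [Form.length]
  | cons ψ l ih =>
    obtain ⟨-, ⟨hlt, -⟩, hl⟩ := isAltChain_cons_cons.1 h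
    exact (Nat.succ_le_of_lt (ih hl)).trans_lt hlt.length_lt

theorem IsAltChain.sameCluster [Infinite Var] {φ : Form Var} {l : List (Form Var)}
    (h : IsAltChain (φ :: l)) : ∀ ψ ∈ φ :: l, SameCluster φ ψ := by
  induction l generalizing φ with
  | nil => simpa using SameCluster.refl φ
  | cons χ l ih =>
    obtain ⟨hφ, ⟨hlt, -⟩, hl⟩ := isAltChain_cons_cons.1 h
    intro ψ hψ
    rcases List.mem_cons.1 hψ with rfl | hψ
    · exact .refl _
    · exact (hlt.sameCluster hφ.1).trans (ih hl ψ hψ)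

theorem bddAbove_length_altChain (φ : Form Var) :
    BddAbove {n | ∃ l : List (Form Var), IsAltChain l ∧ l.head? = some φ ∧ l.length = n} := by
  refine ⟨φ.length, ?_⟩
  rintro _ ⟨_ | ⟨ψ, l⟩, hl, he, rfl⟩
  · simp at he
  · obtain rfl : ψ = φ := by simpa using he
    exact hl.length_lt

theorem IsAltChain.length_le_hUp {φ : Form Var} {l : List (Form Var)} (h : IsAltChain (φ :: l)) :
    l.length + 1 ≤ hUp φ :=
  le_csSup (bddAbove_length_altChain φ) ⟨φ :: l, h, rfl, rfl⟩

theorem exists_length_eq_hUp {φ : Form Var} (hφ : φ.Tidy) (hf : IsFix φ) :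
    ∃ l, IsAltChain (φ :: l) ∧ l.length + 1 = hUp φ := by
  have hne : {n | ∃ l : List (Form Var), IsAltChain l ∧ l.head? = some φ ∧
      l.length = n}.Nonempty := ⟨1, [φ], isAltChain_singleton.2 ⟨hφ, hf⟩, rfl, rfl⟩
  obtain ⟨_ | ⟨ψ, l⟩, hl, he, hn⟩ := Nat.sSup_mem hne (bddAbove_length_altChain φ)
  · simp at he
  · obtain rfl : ψ = φ := by simpa using he
    exact ⟨l, hl, hn⟩

theorem closureDepth_eq {φ ψ : Form Var} (h : SameCluster φ ψ) :
    closureDepth φ = closureDepth ψ := by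
  have : ∀ χ, SameCluster φ χ ↔ SameCluster ψ χ := fun χ => ⟨h.symm.trans, h.trans⟩
  simp only [closureDepth, this]

theorem closureDepth_le_alternationDepth [Infinite Var] {ξ φ : Form Var} (hξ : ξ.Tidy)
    (h : Reach ξ φ) : closureDepth φ ≤ alternationDepth ξ hξ.1 := by
  refine csSup_le' ?_
  rintro _ ⟨l, hl, hc, rfl⟩
  exact hl.length_le_alternationDepth hξ fun ψ hψ => ReflTransGen.trans h (hc ψ hψ).1

theorem hUp_le_closureDepth [Infinite Var] {φ : Form Var} (hφ : φ.Tidy) (hf : IsFix φ) :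
    hUp φ ≤ closureDepth φ := by
  obtain ⟨l, hl, hn⟩ := exists_length_eq_hUp hφ hf
  -- Only boundedness is at stake here: the supremum of an unbounded set of naturals would be `0`.
  refine le_csSup ⟨alternationDepth φ hφ.1, ?_⟩ ⟨φ :: l, hl, hl.sameCluster, hn⟩
  rintro _ ⟨l, hl, hc, rfl⟩
  exact hl.length_le_alternationDepth hφ fun ψ hψ => (hc ψ hψ).1

/-! ### The largest formula of a cluster and the uniform parity correction -/

/-- A cluster with a fixpoint formula has a `⊑_C`-largest fixpoint formula. -/
theorem exists_top [Infinite Var] {φ : Form Var} (hφ : φ.Tidy) (hf : IsFix φ) :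
    ∃ ψ, SameCluster φ ψ ∧ IsFix ψ ∧ ∀ ρ, SameCluster φ ρ → ReachVia ψ ψ ρ := by
  obtain ⟨ψ, hψ, hmin⟩ := (measure (Form.length (Var := Var))).wf.has_min {ρ | SameCluster φ ρ}
    ⟨φ, .refl φ⟩
  replace hmin : ∀ ρ, SameCluster φ ρ → ψ.length ≤ ρ.length :=
    fun ρ hρ => not_lt.1 (hmin ρ hρ)
  have hψφ : SameCluster φ ψ := hψ
  have hψt := (hψφ.1.tidy hφ).1
  -- Induction backwards along a trace to `ψ`. After abstraction the step is still a trace step, and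
  -- these create no free variables, so the fresh `z` is free before the step if it is free after
  -- it.
  have hsub : ∀ ρ, SameCluster φ ρ → FreeSub ψ ρ := by
    intro ρ hρ
    have hr : Reach ρ ψ := ReflTransGen.trans hρ.2 hψφ.1
    induction hr using ReflTransGen.head_induction_on with
    | refl => exact .refl ψ
    | @head ρ σ hs hr ih =>
      by_cases he : ρ = ψ
      · rw [he]; exact .refl ψ
      have hσ : SameCluster φ σ := ⟨ReflTransGen.tail hρ.1 hs, ReflTransGen.trans hr hψφ.2⟩
      have hρt := (hρ.1.tidy hφ).1
      have hd : Disjoint ψ.FV ρ.BV :=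
        hρt.2.mono_left (Reach.tidy (ReflTransGen.trans hρ.2 hψφ.1) hρt).2
      obtain ⟨z, hz⟩ := Infinite.exists_notMem_finset (ρ.FV ∪ ρ.BV)
      obtain ⟨hzf, hzb⟩ := not_or.1 (mt Finset.mem_union.2 hz)
      have hm := (ih hσ).mem_fv_abstr fun hm => hzb (hs.bv_subset hm)
      exact freeSub_of_mem_fv_abstr hρt.1 hzf hzb hd
        (((hs.abstr he (hmin ρ hρ) hd hzb).tidy (hρt.abstr hzb)).2 hm)
  refine ⟨ψ, hψφ, ?_, fun ρ hρ => ⟨.refl ψ, ?_⟩⟩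
  · rcases hψφ.2.cases_head with rfl | ⟨σ, hs, hr⟩
    · exact hf
    -- A step from a formula that is not a fixpoint formula shortens it, and here it stays in the
    -- cluster, against the minimality of `ψ`.
    · by_contra hn
      have hlt := hs.length_lt (by
        cases ho : ψ.fixOp? with
        | none => simp [globalPriority, ho]
        | some η => exact absurd ⟨η, ho⟩ hn)
      exact (hmin σ ⟨ReflTransGen.tail hψφ.1 hs, hr⟩).not_gt hlt
  · have hr : Reach ψ ρ := ReflTransGen.trans hψφ.2 hρ.1
    have hback := hρ.2
    clear hψ
    induction hr with
    | refl => exact .refl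
    | @tail ρ σ hr hs ih =>
      have hρ' : SameCluster φ ρ := ⟨ReflTransGen.trans hψφ.1 hr, ReflTransGen.head hs hback⟩
      exact (ih hρ' hρ'.2).tail ⟨hs, hsub _ hρ⟩

/-- Alternating chains can be prolonged such that their last operator is that of the `⊑_C`-largest
formula `ψ` of the cluster. -/
theorem IsAltChain.exists_extension [Infinite Var] {ψ φ : Form Var} {l : List (Form Var)}
    (hψt : ψ.Tidy) (hψ : IsFix ψ) (htop : ∀ ρ, SameCluster ψ ρ → ReachVia ψ ψ ρ)
    (hφψ : SameCluster ψ φ) (h : IsAltChain (φ :: l)) :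
    ∃ l', IsAltChain (φ :: l') ∧ l.length ≤ l'.length ∧
      (Even l'.length ↔ φ.fixOp? = ψ.fixOp?) := by
  induction l generalizing φ with
  | nil =>
    by_cases he : φ.fixOp? = ψ.fixOp?
    · exact ⟨[], h, le_rfl, by simp [he]⟩
    · obtain ⟨η, hη⟩ := hψ
      obtain ⟨hφt, θ, hθ⟩ := h.head
      have hne : θ ≠ η := fun e => he (by rw [hη, hθ, e])
      have hle : ClosLE φ ψ := ⟨⟨θ, hθ⟩, ⟨η, hη⟩, htop φ hφψ⟩
      refine ⟨[ψ], isAltChain_cons_cons.2 ⟨h.head, ⟨⟨hle, fun h' => he ?_⟩, ?_⟩,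
        isAltChain_singleton.2 ⟨hψt, η, hη⟩⟩, Nat.zero_le _, by simp [he]⟩
      · rw [hle.antisymm h']
      · rw [hη, hθ, FixOp.eq_dual_of_ne hne, Option.map_some, FixOp.dual_dual]
  | cons χ l ih =>
    obtain ⟨hφ, ⟨hlt, hop⟩, hl⟩ := isAltChain_cons_cons.1 h
    obtain ⟨l', hl', hlen, hpar⟩ := ih (hφψ.trans (hlt.sameCluster hφ.1)) hl
    refine ⟨χ :: l', isAltChain_cons_cons.2 ⟨hφ, ⟨hlt, hop⟩, hl'⟩, by simpa using hlen, ?_⟩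
    rw [List.length_cons, Nat.even_add_one, hpar, hop]
    obtain ⟨η, hη⟩ := hψ
    obtain ⟨-, θ, hθ⟩ := hφ
    rw [hη, hθ]
    cases η <;> cases θ <;> simp [FixOp.dual]

/-- In a cluster the parity correction of the global priority map is the same everywhere. -/
theorem exists_globalPriority_eq [Infinite Var] {φ : Form Var} (hφ : φ.Tidy) (hf : IsFix φ) :
    ∃ c, ∀ ρ, SameCluster φ ρ → IsFix ρ →
      globalPriority ρ = some (closureDepth φ - hUp ρ + c) := by
  classical
  obtain ⟨ψ, hψφ, hψ, htop⟩ := exists_top hφ hf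
  obtain ⟨η, hη⟩ := hψ
  -- By the extension lemma `hUp ρ` is odd exactly when `ρ` has the operator `η` of the top formula.
  -- So `closureDepth φ - hUp ρ` has the parity of the operator of `ρ` iff `closureDepth φ + 1` has
  -- parity `η`, a condition independent of `ρ`.
  refine ⟨if η.HasParity (closureDepth φ + 1) then 0 else 1, fun ρ hρ ⟨θ, hθ⟩ => ?_⟩
  have hρt := (hρ.1.tidy hφ).1
  obtain ⟨l, hl, hn⟩ := exists_length_eq_hUp hρt ⟨θ, hθ⟩
  obtain ⟨l', hl', hlen, hpar⟩ := hl.exists_extension (hψφ.1.tidy hφ).1 ⟨η, hη⟩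
    (fun ρ h => htop ρ (hψφ.trans h)) (hψφ.symm.trans hρ)
  have hn' := hl'.length_le_hUp
  have hle := hUp_le_closureDepth hρt ⟨θ, hθ⟩
  rw [← closureDepth_eq hρ] at hle
  have key : θ.HasParity (closureDepth φ - hUp ρ) ↔ η.HasParity (closureDepth φ + 1) := by
    obtain ⟨m, hm⟩ := Nat.exists_eq_add_of_le hle
    rw [hη, hθ] at hpar
    have hu : hUp ρ = l'.length + 1 := by omega
    rw [hm, Nat.add_sub_cancel_left, hu]
    cases η <;> cases θ <;> simp [FixOp.HasParity] at hpar ⊢ <;> grind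
  simp only [globalPriority, hθ, Option.map_some, ← closureDepth_eq hρ, key]
  split_ifs <;> rfl

/-! ### The index of the closure graph -/

theorem clusterIndex_le_closureDepth [Infinite Var] {ξ : Form Var} (h : ξ.Tidy)
    (v : (closureParityFormula ξ h).V) :
    (closureParityFormula ξ h).clusterIndex v ≤ closureDepth v.1 := by
  refine csSup_le' ?_
  rintro _ ⟨l, ⟨hs, hl⟩, hc, rfl⟩
  have hcl : ∀ w ∈ l, SameCluster v.1 w.1 := fun w hw =>
    ⟨(hc w hw).1.lift Subtype.val fun _ _ => id, (hc w hw).2.lift Subtype.val fun _ _ => id⟩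
  have hfix : ∀ w ∈ l, IsFix w.1 := fun w hw => by
    have := hs w hw
    obtain ⟨w, hw'⟩ := w
    cases ho : w.fixOp? with
    | none => simp [closureParityFormula, globalPriority, ho] at this
    | some η => exact ⟨η, ho⟩
  cases l with
  | nil => exact Nat.zero_le _
  | cons u l =>
    have hut : u.1.Tidy := (Reach.tidy u.2 h).1
    have hu := hcl u List.mem_cons_self
    obtain ⟨c, hΩ⟩ := exists_globalPriority_eq hut (hfix u List.mem_cons_self)
    rw [closureDepth_eq hu]
    -- As `1 ≤ hUp w ≤ closureDepth u`, the priorities lie in the interval from `c` to `closureDepth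
    -- u + c`, upper end excluded.
    have bound : ∀ w ∈ u :: l, ∃ n, globalPriority w.1 = some n ∧ c ≤ n ∧
        n < closureDepth u.1 + c := by
      intro w hw
      have hwu := hu.symm.trans (hcl w hw)
      have hwt : w.1.Tidy := (Reach.tidy w.2 h).1
      refine ⟨_, hΩ w.1 hwu (hfix w hw), by omega, ?_⟩
      obtain ⟨l', -, hn⟩ := exists_length_eq_hUp hwt (hfix w hw)
      have := hUp_le_closureDepth hwt (hfix w hw)
      rw [← closureDepth_eq hwu] at this
      omega
    have main : ∀ (l : List (closureParityFormula ξ h).V) (w : (closureParityFormula ξ h).V),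
        (∀ x ∈ w :: l, ∃ n, globalPriority x.1 = some n ∧ c ≤ n ∧ n < closureDepth u.1 + c) →
        (w :: l).IsChain (fun u v => ∃ m n, (closureParityFormula ξ h).Ω u = some m ∧
          (closureParityFormula ξ h).Ω v = some n ∧ m < n ∧ (Even m ↔ ¬ Even n)) →
        ∀ m, globalPriority w.1 = some m → m + l.length < closureDepth u.1 + c := by
      intro l
      induction l with
      | nil =>
        intro w hb _ m hm
        obtain ⟨n, hn, -, hlt⟩ := hb w List.mem_cons_self
        rw [hm, Option.some_inj] at hn
        simpa [hn] using hlt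
      | cons w' l ih =>
        intro w hb hch m hm
        obtain ⟨⟨m', n, hm', hn, hlt, -⟩, hch⟩ := List.isChain_cons_cons.1 hch
        have := ih w' (fun x hx => hb x (List.mem_cons_of_mem _ hx)) hch n hn
        have hmm : m = m' := Option.some_inj.1 (hm.symm.trans hm')
        simp only [List.length_cons]
        omega
    obtain ⟨n, hn, hcn, -⟩ := bound u List.mem_cons_self
    have := main l u bound hl n hn
    simp only [List.length_cons]
    omega

end MuCalc

theorem mainTheorem5 {Var : Type u} [DecidableEq Var] [Infinite Var]
    (ξ : MuCalc.Form Var) (h : ξ.Tidy) :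
    (MuCalc.closureParityFormula ξ h).index ≤ MuCalc.alternationDepth ξ h.1 :=
  ciSup_le' fun v => (MuCalc.clusterIndex_le_closureDepth h v).trans
    (MuCalc.closureDepth_le_alternationDepth h v.2)
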